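/- **Setting.** Let $d\ge 1$. A finite non-empty set $\mathcal D\subset U(d)$ of $K$ unitary matrices is a *unitary 2-design* if for every operator $\rho$ on $\mathbb C^d\otimes\mathbb C^d$ $$\frac1K\sum_{W\in\mathcal D}(W\otimes W)\,\rho\,(W\otimes W)^\dagger=\int_{U(d)}(W\otimes W)\,\rho\,(W\otimes W)^\dagger\,dW ,$$ where $dW$ is the normalized Haar measure. Its *frame potential* is $\mathcal P(\mathcal D)=K^{-2}\sum_{W,W'\in\mathcal D}|\operatorname{tr}W^\dagger W'|^4$. For a unitary representation $U:g\mapsto U_g$ of a finite group $G$ on $\mathbb C^d$, let $Z(U)$ be the set of those $U_g$ that commute with every $U_h$. A *group design induced by $U$*, written $\mathcal D_U$, is a transversal of $\{U_g \mid g\in G\}/Z(U)$: a subset of $\{U_g\mid g\in G\}$ that contains exactly one element of each coset $U_gZ(U)$. For complex functions on $G$ put $\langle\zeta,\chi\rangle=|G|^{-1}\sum_g\overline{\zeta(g)}\chi(g)$ and $\|\zeta\|^2=\langle\zeta,\zeta\rangle$. **Theorem (Group designs).** Let $G$ be a finite group, let $U$ be a unitary representation of $G$ on $\mathbb C^d$,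 $d\ge1$, with character $\chi$, and let $\mathcal D_U$ be any group design induced by $U$. If $d\ge 2$, the following are equivalent: 1. $\mathcal D_U$ is a unitary 2-design. 2. The representation $U^{(2)}:g\mapsto U_g\otimes U_g$ has no more than two irreducible components, counted with multiplicity. 3. The character $\zeta_{U^{(2)}}$ of $U^{(2)}$ satisfies $\|\zeta_{U^{(2)}}\|^2=2$. 4. Both $\chi_S(g)=\tfrac12(\chi(g)^2+\chi(g^2))$ and $\chi_A(g)=\tfrac12(\chi(g)^2-\chi(g^2))$ are irreducible characters of $G$. Further: 5. If $d\ge2$ and $\mathcal D_U$ is a unitary 2-design, then $|\mathcal D_U|$ is a multiple of $d$, of $\tfrac12d(d+1)$ and of $\tfrac12d(d-1)$. 6. Let $V$ be a unitary representation on $\mathbb C^d$ of a finite group $H$ with $\{V_h\mid h\in H\}\supseteq\{U_g\mid g\in G\}$. Then $\mathcal P(\{V_h\mid h\in H\})\le\mathcal P(\{U_g\mid g\in G\})$. If moreover $V$ is irreducible (in particular, if $U$ is irreducible), then also $\mathcal P(\mathcal D_V)\le\mathcal P(\mathcal D_U)$ for every group design $\mathcal D_V$ induced by $V$. 7. The frame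 potential of the matrix group $\{U_g\mid g\in G\}$ is an integer. If $U$ is irreducible, then $\mathcal P(\mathcal D_U)$ is an integer as well. 8. If $\mathcal D_U$ is a unitary 2-design, then $U$ is irreducible. 9. If $d>2$ and all the matrices $U_g$ are real, or, more generally, $\chi$ is real-valued, then $\mathcal D_U$ is not a unitary 2-design. -/

import Mathlib

open MeasureTheory
open scoped Matrix Kronecker ComplexConjugate

noncomputable section

namespace GroupDesign

/-- The unitary group `U(d)`, as a group of complex `d × d` matrices. -/
abbrev UGroup (d : ℕ) : Type := Matrix.unitaryGroup (Fin d) ℂ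

instance (d : ℕ) : CompactSpace (UGroup d) := by
  refine isCompact_iff_compactSpace.mp ?_
  have hb : IsCompact (Set.univ.pi fun _ : Fin d =>
      Set.univ.pi fun _ : Fin d => Metric.closedBall (0 : ℂ) 1) :=
    isCompact_univ_pi fun _ => isCompact_univ_pi fun _ => isCompact_closedBall 0 1
  refine IsCompact.of_isClosed_subset hb ?_ ?_
  · have h1 : IsClosed {A : Matrix (Fin d) (Fin d) ℂ | star A * A = 1} :=
      isClosed_eq (by fun_prop) continuous_const
    convert h1 using 1
    ext A
    exact Matrix.mem_unitaryGroup_iff'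
  · intro A hA i _ j _
    simpa using entry_norm_bound_of_unitary hA i j

/-- `U(d)` carries its Borel σ-algebra. -/
instance (d : ℕ) : MeasurableSpace (UGroup d) := borel _

instance (d : ℕ) : BorelSpace (UGroup d) := ⟨rfl⟩

/-- The normalized Haar measure `dU` of `U(d)`. -/
def haarU (d : ℕ) : Measure (UGroup d) := Measure.haarMeasure ⊤

instance (d : ℕ) : IsProbabilityMeasure (haarU d) := ⟨Measure.haarMeasure_self⟩

/-- The matrix of `U ⊗ U` on `ℂ^d ⊗ ℂ^d`. -/
def tensorSq {d : ℕ} (U : UGroup d) : Matrix (Fin d × Fin d) (Fin d × Fin d) ℂ :=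
  (U : Matrix (Fin d) (Fin d) ℂ) ⊗ₖ (U : Matrix (Fin d) (Fin d) ℂ)

/-- A finite set `D` of `K` unitaries is a unitary 2-design: it is non-empty and, for every
operator `ρ` on `ℂ^d ⊗ ℂ^d`,
`(1/K) ∑_{U ∈ D} (U ⊗ U) ρ (U ⊗ U)† = ∫_{U(d)} (U ⊗ U) ρ (U ⊗ U)† dU`.
The integral of the (continuous, bounded) matrix-valued function is taken entry by entry. -/
def IsUnitaryTwoDesign {d : ℕ} (D : Finset (UGroup d)) : Prop :=
  D.Nonempty ∧
  ∀ (ρ : Matrix (Fin d × Fin d) (Fin d × Fin d) ℂ) (i j : Fin d × Fin d),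
    (D.card : ℂ)⁻¹ * ∑ U ∈ D, (tensorSq U * ρ * (tensorSq U)ᴴ) i j
      = ∫ U : UGroup d, (tensorSq U * ρ * (tensorSq U)ᴴ) i j ∂(haarU d)

/-- The frame potential `(1/K²) ∑_{U, U' ∈ D} |tr (U† U')|⁴` of a finite set of `K` unitaries. -/
def framePotential {d : ℕ} (D : Finset (UGroup d)) : ℝ :=
  (∑ U ∈ D, ∑ U' ∈ D,
    ‖Matrix.trace ((U : Matrix (Fin d) (Fin d) ℂ)ᴴ * (U' : Matrix (Fin d) (Fin d) ℂ))‖ ^ 4)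
    / (D.card : ℝ) ^ 2

section Rep

variable {G : Type*} [Group G] {d : ℕ}

/-- The representation on `ℂ^d` given by a homomorphism into `U(d)`. -/
def rep (U : G →* UGroup d) : Representation ℂ G (Fin d → ℂ) where
  toFun g := Matrix.toLin' (U g : Matrix (Fin d) (Fin d) ℂ)
  map_one' := by simp [Module.End.one_eq_id]
  map_mul' g h := by simp [Matrix.toLin'_mul, Module.End.mul_eq_comp]

/-- The representation `U^(2) : g ↦ U_g ⊗ U_g` on `ℂ^d ⊗ ℂ^d`. -/
def rep2 (U : G →* UGroup d) : Representation ℂ G (TensorProduct ℂ (Fin d → ℂ) (Fin d → ℂ)) :=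
  (rep U).tprod (rep U)

/-- `ρ` is the direct sum of `n` irreducible subrepresentations, i.e. `ρ` has `n` irreducible
components, counted with multiplicity. -/
def HasIrreducibleComponents {V : Type*} [AddCommGroup V] [Module ℂ V]
    (ρ : Representation ℂ G V) (n : ℕ) : Prop :=
  ∃ W : Fin n → Subrepresentation ρ,
    DirectSum.IsInternal (fun i => (W i).toSubmodule) ∧
      ∀ i, (W i).toRepresentation.IsIrreducible

/-- The scalar product `⟨ζ, χ⟩ = |G|⁻¹ ∑_g conj (ζ g) χ g` of complex functions on `G`. -/
def charInner [Fintype G] (ζ χ : G → ℂ) : ℂ :=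
  (Fintype.card G : ℂ)⁻¹ * ∑ g, conj (ζ g) * χ g

/-- `χ` is the character of an irreducible finite-dimensional complex representation. -/
def IsIrreducibleCharacter (χ : G → ℂ) : Prop :=
  ∃ (n : ℕ) (ρ : Representation ℂ G (Fin n → ℂ)), ρ.IsIrreducible ∧ ρ.character = χ

/-- `χ_S g = (χ(g)² + χ(g²)) / 2`. -/
def symSquare (χ : G → ℂ) (g : G) : ℂ := (χ g ^ 2 + χ (g ^ 2)) / 2

/-- `χ_A g = (χ(g)² - χ(g²)) / 2`. -/
def altSquare (χ : G → ℂ) (g : G) : ℂ := (χ g ^ 2 - χ (g ^ 2)) / 2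

/-- The matrix group `{U_g | g ∈ G}`, as a finite set of unitaries. -/
def matrixGroup [Finite G] (U : G →* UGroup d) : Finset (UGroup d) :=
  (Set.finite_range U).toFinset

/-- The center `Z(U)`: the matrices `U_g` that commute with every `U_h`. -/
def repCenter (U : G →* UGroup d) : Set (UGroup d) :=
  {z | z ∈ Set.range U ∧ ∀ h : G, z * U h = U h * z}

/-- `D` is a group design induced by `U`: a transversal of `{U_g | g ∈ G} / Z(U)`, i.e. a set of
elements of `{U_g | g ∈ G}` that meets each coset `U_g Z(U)` in exactly one element. -/
def IsInducedBy (D : Finset (UGroup d)) (U : G →* UGroup d) : Prop :=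
  (∀ x ∈ D, x ∈ Set.range U) ∧
    ∀ g : G, ∃! x : UGroup d, x ∈ D ∧ ∃ z ∈ repCenter U, x = U g * z

end Rep

end GroupDesign

end

/-
Conjugation by `U_g ⊗ U_g` only depends on `U_g` up to a phase. If `U` is irreducible, `Z(U)`
consists of phases by Schur's lemma, so averaging over `D` is the same as averaging over `G`, that
is, projecting onto the commutant of `U ⊗ U`. The Haar average projects onto the commutant of all
`V ⊗ V`, which is spanned by the identity and the swap (Schur–Weyl duality for the tensor square).
Hence `D` is a 2-design if and only if the commutant of `U ⊗ U` is spanned by these two operators;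
applied to `A ⊗ 1`, this forces `U` to be irreducible. The dimension of the commutant is
`‖ζ_{U^(2)}‖²`, and the eigenspaces of the swap carry the symmetric and alternating squares, which
are therefore the irreducible components of `U ⊗ U` when the dimension is two.

For the divisibilities, the dimension of an irreducible representation divides the index of any
subgroup acting by scalars, and `|D|` is the index of the subgroup mapping to `Z(U)`.

The frame potential of `D` is the squared Hilbert–Schmidt norm of the twirl over `D`. For a group
the twirl is an orthogonal projection that absorbs the twirl over any subset of the group, so it has
the least norm among them, and its trace is the integer `‖ζ_{U^(2)}‖²`.

If `χ` is real, then `⟨χ², 1⟩ = ⟨χ, χ⟩ = 1`, so `U ⊗ U` has a trivial component, which for `d > 2`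
is smaller than both the symmetric and the alternating square.
-/

namespace GroupDesign

open Representation Module

section Irreducibility

variable {k G V : Type*} [Field k] [Monoid G] [AddCommGroup V] [Module k V]
  {ρ : Representation k G V}

/-- The subrepresentations of a subrepresentation `σ` of `ρ` are the subrepresentations of `ρ` below
`σ`: the counterpart of `Submodule.mapIic`, which turns irreducibility into a lattice property. -/
def subrepresentationMapIic (σ : Subrepresentation ρ) :
    Subrepresentation σ.toRepresentation ≃o Set.Iic σ where
  toFun τ := ⟨⟨τ.toSubmodule.map σ.toSubmodule.subtype, by
      rintro g _ ⟨v, hv, rfl⟩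
      exact ⟨_, τ.apply_mem_toSubmodule g hv, rfl⟩⟩,
    Submodule.map_subtype_le _ _⟩
  invFun τ := ⟨τ.1.toSubmodule.comap σ.toSubmodule.subtype,
    fun g _ hv => τ.1.apply_mem_toSubmodule g hv⟩
  left_inv τ := Subrepresentation.toSubmodule_injective
    (Submodule.comap_map_eq_of_injective σ.toSubmodule.injective_subtype _)
  right_inv τ := Subtype.ext (Subrepresentation.toSubmodule_injective
    ((Submodule.map_comap_subtype _ _).trans (inf_eq_right.2 τ.2)))
  map_rel_iff' := Submodule.map_le_map_iff_of_injective σ.toSubmodule.injective_subtype _ _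

theorem isAtom_iff_isIrreducible (σ : Subrepresentation ρ) :
    IsAtom σ ↔ σ.toRepresentation.IsIrreducible :=
  Set.isSimpleOrder_Iic_iff_isAtom.symm.trans (subrepresentationMapIic σ).isSimpleOrder_iff.symm

theorem isAtom_of_isCompl_isAtom {α : Type*} [Lattice α] [BoundedOrder α] [IsModularLattice α]
    {a b s : α} (ha : IsAtom a) (hb : IsAtom b) (hab : IsCompl a b) (h0 : s ≠ ⊥) (h1 : s ≠ ⊤) :
    IsAtom s := by
  have hco : IsCoatom a := hab.isCoatom_iff_isAtom.2 hb
  by_cases has : a ≤ s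
  · rcases hco.le_iff.1 has with h | rfl
    · exact absurd h h1
    · exact ha
  · have hsa : ¬ s ≤ a := fun h => (ha.le_iff.1 h).elim h0 fun h => has h.ge
    have hcompl : IsCompl a s :=
      ⟨ha.not_le_iff_disjoint.1 has, hco.not_le_iff_codisjoint.1 hsa⟩
    exact hcompl.isCoatom_iff_isAtom.1 hco

instance : IsModularLattice (Subrepresentation ρ) where
  sup_inf_le_assoc_of_le {x} y z h :=
    IsModularLattice.sup_inf_le_assoc_of_le (x := x.toSubmodule) y.toSubmodule
      (z := z.toSubmodule) h

theorem isCompl_toSubmodule_iff {σ τ : Subrepresentation ρ} :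
    IsCompl σ.toSubmodule τ.toSubmodule ↔ IsCompl σ τ := by
  rw [isCompl_iff, isCompl_iff, disjoint_iff, disjoint_iff, codisjoint_iff, codisjoint_iff,
    ← Subrepresentation.toSubmodule_inf, ← Subrepresentation.toSubmodule_sup]
  exact and_congr (Subrepresentation.toSubmodule_injective.eq_iff (b := (⊥ : Subrepresentation ρ)))
    (Subrepresentation.toSubmodule_injective.eq_iff (b := (⊤ : Subrepresentation ρ)))

theorem HasIrreducibleComponents.isAtom_of_isCompl {G V : Type*} [Group G]
    [AddCommGroup V] [Module ℂ V] {ρ : Representation ℂ G V} {n : ℕ}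
    (hn : n ≤ 2) (h : HasIrreducibleComponents ρ n) {σ τ : Subrepresentation ρ}
    (hc : IsCompl σ τ) (hσ : σ ≠ ⊥) (hτ : τ ≠ ⊥) : IsAtom σ := by
  obtain ⟨W, hW, hirr⟩ := h
  have hatom : ∀ i, IsAtom (W i) := fun i => (isAtom_iff_isIrreducible _).2 (hirr i)
  have hσ' : σ ≠ ⊤ := fun e => hτ (by simpa [e] using hc.inf_eq_bot)
  have hsup := hW.submodule_iSup_eq_top
  interval_cases n
  · rw [iSup_of_empty] at hsup
    have hσ_bot : σ.toSubmodule = ⊥ := eq_bot_iff.2 (hsup ▸ le_top)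
    exact absurd (Subrepresentation.toSubmodule_injective hσ_bot) hσ
  · have hW0 : W 0 = ⊤ := Subrepresentation.toSubmodule_injective (by simpa using! hsup)
    have hσ_le := (hatom 0).le_iff.1 (hW0 ▸ le_top : σ ≤ W 0)
    exact absurd hσ_le (by simp [hW0, hσ, hσ'])
  · have hW01 : IsCompl (W 0) (W 1) := isCompl_toSubmodule_iff.1
      ((DirectSum.isInternal_submodule_iff_isCompl _ (i := (0 : Fin 2)) (j := 1) (by decide)
        (by ext i; fin_cases i <;> simp)).1 hW)
    exact isAtom_of_isCompl_isAtom (hatom 0) (hatom 1) hW01 hσ hσ'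

theorem nontrivial_of_isIrreducible (h : ρ.IsIrreducible) : Nontrivial V := by
  by_contra hV
  rw [not_nontrivial_iff_subsingleton] at hV
  exact bot_ne_top (α := Subrepresentation ρ)
    (Subrepresentation.toSubmodule_injective (Subsingleton.elim _ _))

theorem exists_eq_smul_id_of_commute [FiniteDimensional k V] [IsAlgClosed k]
    (h : ρ.IsIrreducible) (f : V →ₗ[k] V) (hf : ∀ g, f ∘ₗ ρ g = ρ g ∘ₗ f) :
    ∃ c : k, f = c • LinearMap.id := by
  obtain ⟨c, hc⟩ := (IsIrreducible.algebraMap_intertwiningMap_bijective_of_isAlgClosed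
    (ρ := ρ)).2 ⟨f, hf⟩
  exact ⟨c, by simpa using! (congrArg IntertwiningMap.toLinearMap hc).symm⟩

/-- The projection onto a subrepresentation along a complementary one, as an intertwining map. -/
noncomputable def projectionOfIsCompl {σ τ : Subrepresentation ρ} (h : IsCompl σ τ) :
    IntertwiningMap ρ ρ where
  __ := Submodule.projection _ _ (isCompl_toSubmodule_iff.2 h)
  isIntertwining' g := by
    have hc := isCompl_toSubmodule_iff.2 h
    have hproj : ∀ x ∈ σ.toSubmodule, ∀ y ∈ τ.toSubmodule,
        Submodule.projection _ _ hc (x + y) = x := fun x hx y hy => by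
      rw [map_add, (Submodule.projection_apply_eq_zero_iff hc).2 hy, add_zero,
        Submodule.projection_apply_of_mem_left hc hx]
    ext v
    obtain ⟨x, hx, y, hy, rfl⟩ := Submodule.mem_sup.1 (hc.sup_eq_top ▸ Submodule.mem_top (x := v))
    change Submodule.projection _ _ hc (ρ g (x + y)) = ρ g (Submodule.projection _ _ hc (x + y))
    rw [map_add, hproj _ (σ.apply_mem_toSubmodule g hx) _ (τ.apply_mem_toSubmodule g hy),
      hproj x hx y hy]

theorem projectionOfIsCompl_apply_of_mem_left {σ τ : Subrepresentation ρ} (h : IsCompl σ τ) {v : V}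
    (hv : v ∈ σ.toSubmodule) : projectionOfIsCompl h v = v :=
  Submodule.projection_apply_of_mem_left (isCompl_toSubmodule_iff.2 h) hv

theorem projectionOfIsCompl_apply_eq_zero_iff {σ τ : Subrepresentation ρ} (h : IsCompl σ τ)
    {v : V} : projectionOfIsCompl h v = 0 ↔ v ∈ τ.toSubmodule :=
  Submodule.projection_apply_eq_zero_iff (isCompl_toSubmodule_iff.2 h)

theorem isIrreducible_of_finrank_eq_one [IsSemisimpleRepresentation ρ]
    (h : finrank k (IntertwiningMap ρ ρ) = 1) : ρ.IsIrreducible := by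
  have : Nontrivial (IntertwiningMap ρ ρ) := nontrivial_of_finrank_eq_succ h
  have hscalar := (finrank_eq_one_iff_of_nonzero' (1 : IntertwiningMap ρ ρ) one_ne_zero).1 h
  have hbot : ∀ σ : Subrepresentation ρ, (∀ v ∈ σ.toSubmodule, v = 0) → σ = ⊥ := fun σ hσ =>
    Subrepresentation.toSubmodule_injective (eq_bot_iff.2 hσ)
  refine { exists_pair_ne := ⟨⊥, ⊤, fun e => ?_⟩, eq_bot_or_eq_top := fun σ => ?_ }
  · refine one_ne_zero (α := IntertwiningMap ρ ρ) (IntertwiningMap.ext (LinearMap.ext fun v => ?_))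
    exact (show v ∈ (⊥ : Subrepresentation ρ) from e ▸ Submodule.mem_top)
  · obtain ⟨τ, hτ⟩ := exists_isCompl σ
    obtain ⟨c, hc⟩ := hscalar (projectionOfIsCompl hτ)
    have hproj : ∀ v, projectionOfIsCompl hτ v = c • v := fun v =>
      (congrArg (fun f : IntertwiningMap ρ ρ => f v) hc).symm
    rcases eq_or_ne c 0 with rfl | hc0
    · refine Or.inl (hbot σ fun v hv => ?_)
      rw [← projectionOfIsCompl_apply_of_mem_left hτ hv, hproj, zero_smul]
    · have hτ_bot : τ = ⊥ := hbot τ fun v hv => by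
        rw [← projectionOfIsCompl_apply_eq_zero_iff hτ, hproj] at hv
        exact (smul_eq_zero.1 hv).resolve_left hc0
      exact Or.inr (by simpa [hτ_bot] using hτ.sup_eq_top)

theorem finrank_intertwiningMap_self_pos [FiniteDimensional k V] [Nontrivial V]
    (ρ : Representation k G V) :
    0 < finrank k (IntertwiningMap ρ ρ) := by
  have : FiniteDimensional k (IntertwiningMap ρ ρ) :=
    Module.Finite.of_injective (IntertwiningMap.toLinearMapl ρ ρ)
      (IntertwiningMap.toLinearMap_injective ρ ρ)
  obtain ⟨v, hv⟩ := exists_ne (0 : V)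
  exact finrank_pos_iff_exists_ne_zero.2 ⟨IntertwiningMap.id ρ, fun h =>
    hv (by simpa using congrArg (fun f : IntertwiningMap ρ ρ => f v) h)⟩

end Irreducibility

section Characters

variable {k G : Type*} [Field k] [Group G]

/-- The pairing `|G|⁻¹ ∑_g χ(g) ψ(g⁻¹)` of functions on `G`. On characters it agrees with
`charInner`, but it is bilinear and makes sense over any field. -/
noncomputable def charPairing [Fintype G] (χ ψ : G → k) : k :=
  (Nat.card G : k)⁻¹ * ∑ g, χ g * ψ g⁻¹

theorem charPairing_add_left [Fintype G] (χ χ' ψ : G → k) :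
    charPairing (χ + χ') ψ = charPairing χ ψ + charPairing χ' ψ := by
  simp [charPairing, add_mul, Finset.sum_add_distrib, mul_add]

theorem charPairing_add_right [Fintype G] (χ ψ ψ' : G → k) :
    charPairing χ (ψ + ψ') = charPairing χ ψ + charPairing χ ψ' := by
  simp [charPairing, Finset.sum_add_distrib, mul_add]

variable {V W : Type*} [AddCommGroup V] [Module k V] [AddCommGroup W] [Module k W]

/-- Transport of a representation along a linear equivalence. -/
def conjRepresentation (e : V ≃ₗ[k] W) (ρ : Representation k G V) : Representation k G W where
  toFun g := e.conj (ρ g)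
  map_one' := by ext; simp
  map_mul' a b := by ext; simp [LinearEquiv.conj_apply]

variable [FiniteDimensional k V] [FiniteDimensional k W]

theorem isIntegral_character [IsAlgClosed k] [Finite G] (ρ : Representation k G V) (g : G) :
    IsIntegral ℤ (ρ.character g) := by
  have hroot : ∀ μ, Module.End.HasEigenvalue (ρ g) μ → μ ^ Nat.card G = 1 := fun μ hμ => by
    obtain ⟨v, hv⟩ := hμ.exists_hasEigenvector
    have hpow := hv.pow_apply (Nat.card G)
    rw [← map_pow, pow_card_eq_one', map_one] at hpow
    exact smul_left_injective k hv.2 (by simpa using hpow.symm)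
  rw [Representation.character, LinearMap.trace_eq_matrix_trace k (finBasis k V),
    Matrix.trace_eq_sum_roots_charpoly]
  refine IsIntegral.multiset_sum fun μ hμ => .of_pow (n := Nat.card G) Nat.card_pos ?_
  rw [hroot μ]
  · exact isIntegral_one
  · rw [Module.End.hasEigenvalue_iff_isRoot_charpoly,
      ← LinearMap.charpoly_toMatrix (ρ g) (finBasis k V)]
    exact Polynomial.isRoot_of_mem_roots hμ

variable [CharZero k]

noncomputable local instance [Finite G] : Invertible (Nat.card G : k) :=
  invertibleOfNonzero (Nat.cast_ne_zero.2 Nat.card_pos.ne')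

theorem charPairing_character [Fintype G] (ρ : Representation k G V) (σ : Representation k G W) :
    charPairing σ.character ρ.character = finrank k (IntertwiningMap ρ σ) :=
  card_inv_mul_sum_char_mul_char_eq_finrank ρ σ

variable [IsAlgClosed k]

theorem charPairing_eq_zero [Fintype G] {ρ : Representation k G V} {σ : Representation k G W}
    [ρ.IsIrreducible] [σ.IsIrreducible] (h : finrank k V ≠ finrank k W) :
    charPairing ρ.character σ.character = 0 :=
  (char_orthonormal ρ σ).trans (if_neg fun ⟨e⟩ => h e.toLinearEquiv.finrank_eq.symm)

theorem isIrreducible_iff_charPairing [Fintype G] (ρ : Representation k G V) :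
    ρ.IsIrreducible ↔ charPairing ρ.character ρ.character = 1 := by
  have : NeZero (Nat.card G : k) := ⟨Nat.cast_ne_zero.2 Nat.card_pos.ne'⟩
  rw [charPairing_character]
  refine ⟨fun h => ?_, fun h => isIrreducible_of_finrank_eq_one (by exact_mod_cast h)⟩
  rw [IsIrreducible.finrank_intertwiningMap_self, Nat.cast_one]

theorem charPairing_one_eq_zero [Fintype G] {ρ : Representation k G V} (hρ : ρ.IsIrreducible)
    (h : finrank k V ≠ 1) : charPairing ρ.character 1 = 0 := by
  have hchar : (Representation.trivial k G k).character = 1 := funext fun _ => by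
    change LinearMap.trace k k LinearMap.id = 1
    rw [LinearMap.trace_id, finrank_self, Nat.cast_one]
  have htriv : (Representation.trivial k G k).IsIrreducible := by
    rw [isIrreducible_iff_charPairing, hchar, charPairing]
    simp [← Nat.card_eq_fintype_card]
  rw [← hchar]
  exact charPairing_eq_zero (by rwa [finrank_self])

theorem isIrreducible_congr_of_character_eq [Finite G] {ρ : Representation k G V}
    {σ : Representation k G W} (h : ρ.character = σ.character) :
    ρ.IsIrreducible ↔ σ.IsIrreducible := by
  have := Fintype.ofFinite G
  rw [isIrreducible_iff_charPairing, isIrreducible_iff_charPairing, h]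

theorem isIrreducibleCharacter_iff {V : Type*} [AddCommGroup V] [Module ℂ V]
    [FiniteDimensional ℂ V] [Finite G] (ρ : Representation ℂ G V) :
    IsIrreducibleCharacter ρ.character ↔ ρ.IsIrreducible := by
  constructor
  · rintro ⟨n, σ, hσ, h⟩
    exact (isIrreducible_congr_of_character_eq h).1 hσ
  · intro h
    have hσ : (conjRepresentation (finBasis ℂ V).equivFun ρ).character = ρ.character :=
      funext fun g => LinearMap.trace_conj' (ρ g) _
    exact ⟨_, _, (isIrreducible_congr_of_character_eq hσ).2 h, hσ⟩

end Characters

section Divisibility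

theorem natCast_dvd_of_isIntegral_div {k : Type*} [Field k] [CharZero k] {m n : ℕ} (hn : n ≠ 0)
    (h : IsIntegral ℤ ((m : k) / n)) : n ∣ m := by
  have hn' : (n : ℚ) ≠ 0 := Nat.cast_ne_zero.2 hn
  have hq : IsIntegral ℤ ((m : ℚ) / n) := by
    rw [← isIntegral_algebraMap_iff (B := k) (algebraMap ℚ k).injective]
    simpa using h
  obtain ⟨q, hq⟩ := IsIntegrallyClosed.isIntegral_iff.1 hq
  rw [eq_div_iff hn', eq_intCast] at hq
  exact Int.natCast_dvd_natCast.1 ⟨q, by rw [mul_comm]; exact_mod_cast hq.symm⟩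

theorem sum_eq_card_smul_sum_out {G M : Type*} [Group G] [Fintype G] [AddCommMonoid M]
    (N : Subgroup G) [Fintype (G ⧸ N)] (f : G → M) (hf : ∀ g, ∀ n ∈ N, f (g * n) = f g) :
    ∑ g, f g = Nat.card N • ∑ q : G ⧸ N, f q.out := by
  classical
  have hbij : Function.Bijective fun p : (G ⧸ N) × N => p.1.out * (p.2 : G) := by
    refine ⟨?_, fun g => ?_⟩
    · rintro ⟨q, n⟩ ⟨r, m⟩ h
      have hqr : q = r := by
        have hmul : q.out * n = r.out * (m : G) := h
        simpa using congrArg (QuotientGroup.mk : G → G ⧸ N) hmul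
      subst hqr
      exact Prod.ext rfl (Subtype.ext (mul_left_cancel h))
    · obtain ⟨n, hn⟩ := QuotientGroup.mk_out_eq_mul N g
      exact ⟨(QuotientGroup.mk g, n⁻¹), by simp [hn]⟩
  calc ∑ g, f g = ∑ p : (G ⧸ N) × N, f (p.1.out * p.2) := (hbij.sum_comp f).symm
    _ = ∑ q : G ⧸ N, Nat.card N • f q.out := by
        rw [Fintype.sum_prod_type]
        refine Finset.sum_congr rfl fun q _ => ?_
        simp only [hf _ _ (Subtype.prop _), Finset.sum_const, Finset.card_univ,
          Nat.card_eq_fintype_card]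
    _ = Nat.card N • ∑ q : G ⧸ N, f q.out := Finset.smul_sum.symm

theorem isIntegral_of_sum_eq_smul {k G V : Type*} [Field k] [Monoid G] [Finite G] [AddCommGroup V]
    [Module k V] [Nontrivial V] (ρ : Representation k G V) {ι : Type*} (s : Finset ι) (x : ι → G)
    (a : ι → k) (ha : ∀ i, IsIntegral ℤ (a i)) (c : k)
    (h : ∑ i ∈ s, a i • ρ (x i) = c • LinearMap.id) : IsIntegral ℤ c := by
  let O := integralClosure ℤ k
  let Φ : MonoidAlgebra O G →ₐ[O] Module.End k V := MonoidAlgebra.lift O _ G ρ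
  let y : MonoidAlgebra O G := ∑ i ∈ s, MonoidAlgebra.single (x i) (⟨a i, ha i⟩ : O)
  have hy : Φ y = algebraMap k (Module.End k V) c := by
    rw [Module.algebraMap_end_eq_smul_id, ← h, map_sum]
    exact Finset.sum_congr rfl fun i _ => by simp only [Φ, MonoidAlgebra.lift_single]; rfl
  have hint : IsIntegral O (Φ y) := ((Algebra.IsIntegral.of_finite O _).isIntegral y).map Φ
  rw [hy, isIntegral_algebraMap_iff (FaithfulSMul.algebraMap_injective k _)] at hint
  exact isIntegral_trans c hint

variable {k G V : Type*} [Field k] [Group G] [AddCommGroup V] [Module k V]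
  {ρ : Representation k G V}

theorem character_inv_smul_mul_eq [Nontrivial V] {n : G} {c : k} (hn : ρ n = c • LinearMap.id)
    (g : G) : ρ.character (g * n)⁻¹ • ρ (g * n) = ρ.character g⁻¹ • ρ g := by
  have hmul : ρ (g * n) = c • ρ g := by
    rw [map_mul, hn, Module.End.mul_eq_comp, LinearMap.comp_smul, LinearMap.comp_id]
  have hc : c ≠ 0 := by
    rintro rfl
    obtain ⟨v, hv⟩ := exists_ne (0 : V)
    exact hv (by simpa [hn] using! (ρ.inv_self_apply n v).symm)
  have hinv : ρ n⁻¹ = c⁻¹ • LinearMap.id := by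
    ext v
    have := ρ.inv_self_apply n v
    rw [hn, LinearMap.smul_apply, LinearMap.id_apply, map_smul] at this
    exact (eq_inv_smul_iff₀ hc).2 this
  have hmul' : ρ (g * n)⁻¹ = c⁻¹ • ρ g⁻¹ := by
    rw [mul_inv_rev, map_mul, hinv, Module.End.mul_eq_comp, LinearMap.smul_comp, LinearMap.id_comp]
  rw [character, hmul', map_smul, hmul, smul_smul, smul_eq_mul, mul_right_comm,
    inv_mul_cancel₀ hc, one_mul]
  rfl

variable [IsAlgClosed k] [CharZero k] [FiniteDimensional k V]

theorem finrank_smul_sum_character_inv_smul [Fintype G] (hρ : ρ.IsIrreducible) :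
    (finrank k V : k) • ∑ g, ρ.character g⁻¹ • ρ g = (Nat.card G : k) • LinearMap.id := by
  obtain ⟨c, hc⟩ := exists_eq_smul_id_of_commute hρ (∑ g, ρ.character g⁻¹ • ρ g) fun g => by
    rw [← Module.End.mul_eq_comp, ← Module.End.mul_eq_comp, Finset.sum_mul, Finset.mul_sum]
    refine Fintype.sum_equiv (MulAut.conj g⁻¹).toEquiv _ _ fun x => ?_
    have hconj : ρ.character (g⁻¹ * x * g)⁻¹ = ρ.character x⁻¹ := by
      rw [show (g⁻¹ * x * g)⁻¹ = g⁻¹ * x⁻¹ * g⁻¹⁻¹ by group, char_conj]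
    have happ : (MulAut.conj g⁻¹).toEquiv x = g⁻¹ * x * g := congrArg (_ * ·) (inv_inv g)
    rw [happ, hconj, smul_mul_assoc, mul_smul_comm, ← map_mul, ← map_mul,
      show g * (g⁻¹ * x * g) = x * g by group]
  have htrace : c * finrank k V = Nat.card G := by
    have hone := (isIrreducible_iff_charPairing ρ).1 hρ
    rw [charPairing, inv_mul_eq_one₀ (Nat.cast_ne_zero.2 Nat.card_pos.ne')] at hone
    have htr := congrArg (LinearMap.trace k V) hc
    rw [map_smul, LinearMap.trace_id, smul_eq_mul, map_sum] at htr
    rw [← htr, hone]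
    exact Finset.sum_congr rfl fun g _ => by rw [map_smul, smul_eq_mul, mul_comm]; rfl
  rw [hc, smul_smul, mul_comm, htrace]

-- Summed over `G ⧸ N`, the operators `χ(g⁻¹) ρ(g)` give the scalar `[G : N] / dim V`, an
-- algebraic integer.
theorem finrank_dvd_index [Finite G] (hρ : ρ.IsIrreducible) {N : Subgroup G}
    (hN : ∀ n ∈ N, ∃ c : k, ρ n = c • LinearMap.id) : finrank k V ∣ N.index := by
  have := Fintype.ofFinite G
  have := Fintype.ofFinite (G ⧸ N)
  have := nontrivial_of_isIrreducible hρ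
  have hd : (finrank k V : k) ≠ 0 := Nat.cast_ne_zero.2 finrank_pos.ne'
  have hN0 : (Nat.card N : k) ≠ 0 := Nat.cast_ne_zero.2 Nat.card_pos.ne'
  have hsum := finrank_smul_sum_character_inv_smul hρ
  rw [sum_eq_card_smul_sum_out N _ fun g n hn =>
    let ⟨_, hc⟩ := hN n hn; character_inv_smul_mul_eq hc g,
    ← N.card_mul_index, Nat.cast_mul, ← Nat.cast_smul_eq_nsmul k, smul_comm, mul_smul] at hsum
  have hout : ∑ q : G ⧸ N, ρ.character q.out⁻¹ • ρ q.out =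
      ((N.index : k) / finrank k V) • LinearMap.id := by
    rw [div_eq_inv_mul, mul_smul, eq_inv_smul_iff₀ hd]
    exact smul_right_injective _ hN0 hsum
  exact natCast_dvd_of_isIntegral_div finrank_pos.ne' <|
    isIntegral_of_sum_eq_smul ρ _ Quotient.out _ (fun q => isIntegral_character ρ _) _ hout

theorem finrank_dvd_index_of_isAtom [Finite G] {σ : Subrepresentation ρ} (hσ : IsAtom σ)
    {N : Subgroup G} (hN : ∀ n ∈ N, ∃ c : k, ρ n = c • LinearMap.id) :
    finrank k σ.toSubmodule ∣ N.index :=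
  finrank_dvd_index ((isAtom_iff_isIrreducible σ).1 hσ) fun n hn =>
    let ⟨c, hc⟩ := hN n hn
    ⟨c, LinearMap.ext fun v => Subtype.ext (LinearMap.congr_fun hc v)⟩

end Divisibility

section UnitaryRepresentations

variable {G : Type*} [Group G] {d : ℕ}

theorem coe_map_inv (U : G →* UGroup d) (g : G) :
    (U g⁻¹ : Matrix (Fin d) (Fin d) ℂ) = (U g : Matrix (Fin d) (Fin d) ℂ)ᴴ := by
  rw [map_inv]
  rfl

theorem character_rep (U : G →* UGroup d) (g : G) :
    (rep U).character g = Matrix.trace (U g : Matrix (Fin d) (Fin d) ℂ) :=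
  Matrix.trace_toLin'_eq _

theorem character_rep_inv (U : G →* UGroup d) (g : G) :
    (rep U).character g⁻¹ = conj ((rep U).character g) := by
  rw [character_rep, character_rep, coe_map_inv, Matrix.trace_conjTranspose]
  rfl

theorem character_rep2 (U : G →* UGroup d) (g : G) :
    (rep2 U).character g = (rep U).character g ^ 2 := by
  rw [rep2, char_tensor, Pi.mul_apply, sq]

theorem character_rep2_inv (U : G →* UGroup d) (g : G) :
    (rep2 U).character g⁻¹ = conj ((rep2 U).character g) := by
  rw [character_rep2, character_rep2, character_rep_inv, map_pow]

theorem charInner_rep2 [Fintype G] (U : G →* UGroup d) :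
    charInner (rep2 U).character (rep2 U).character =
      charPairing (rep2 U).character (rep2 U).character := by
  simp only [charInner, charPairing, character_rep2_inv, Fintype.card_eq_nat_card, mul_comm]

theorem exists_eq_smul_one_of_commute {U : G →* UGroup d} (h : (rep U).IsIrreducible)
    (A : Matrix (Fin d) (Fin d) ℂ) (hA : ∀ g, A * U g = U g * A) : ∃ c : ℂ, A = c • 1 := by
  obtain ⟨c, hc⟩ := exists_eq_smul_id_of_commute h (Matrix.toLin' A) fun g => by
    change _ ∘ₗ Matrix.toLin' _ = Matrix.toLin' _ ∘ₗ _
    rw [← Matrix.toLin'_mul, ← Matrix.toLin'_mul, hA]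
  refine ⟨c, Matrix.toLin'.injective ?_⟩
  rw [hc, map_smul, Matrix.toLin'_one]

theorem isIrreducible_rep_of_forall_commute [Finite G] (hd : 1 ≤ d) {U : G →* UGroup d}
    (h : ∀ A : Matrix (Fin d) (Fin d) ℂ, (∀ g, A * U g = U g * A) → ∃ c : ℂ, A = c • 1) :
    (rep U).IsIrreducible := by
  have : NeZero (Nat.card G : ℂ) := ⟨Nat.cast_ne_zero.2 Nat.card_pos.ne'⟩
  have hone : (1 : IntertwiningMap (rep U) (rep U)) ≠ 0 := fun h0 => by
    simpa using! congrArg (fun f : IntertwiningMap (rep U) (rep U) => f (fun _ => 1) ⟨0, hd⟩) h0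
  refine isIrreducible_of_finrank_eq_one ((finrank_eq_one_iff_of_nonzero' _ hone).2 fun f => ?_)
  obtain ⟨c, hc⟩ := h (LinearMap.toMatrix' f.toLinearMap) fun g => Matrix.toLin'.injective <| by
    rw [Matrix.toLin'_mul, Matrix.toLin'_mul, Matrix.toLin'_toMatrix']
    exact f.isIntertwining' g
  refine ⟨c, IntertwiningMap.ext ?_⟩
  have hf := congrArg Matrix.toLin' hc
  rw [Matrix.toLin'_toMatrix', map_smul, Matrix.toLin'_one] at hf
  exact hf.symm

theorem norm_eq_one_of_coe_eq_smul_one (hd : 1 ≤ d) {x : UGroup d} {c : ℂ}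
    (h : (x : Matrix (Fin d) (Fin d) ℂ) = c • 1) : ‖c‖ = 1 := by
  have hentry := congrFun (congrFun (Matrix.mem_unitaryGroup_iff.1 x.2) ⟨0, hd⟩) ⟨0, hd⟩
  simp only [h, star_smul, star_one, Algebra.mul_smul_comm, mul_one, Matrix.smul_apply,
    Matrix.one_apply_eq, smul_eq_mul, RCLike.star_def, Complex.conj_mul'] at hentry
  exact (pow_eq_one_iff_of_nonneg (norm_nonneg c) two_ne_zero).1 (by exact_mod_cast hentry)

theorem exists_coe_eq_smul_one_of_mem_repCenter (hd : 1 ≤ d) {U : G →* UGroup d}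
    (h : (rep U).IsIrreducible) {z : UGroup d} (hz : z ∈ repCenter U) :
    ∃ c : ℂ, ‖c‖ = 1 ∧ (z : Matrix (Fin d) (Fin d) ℂ) = c • 1 := by
  obtain ⟨c, hc⟩ := exists_eq_smul_one_of_commute h z fun g => congrArg Subtype.val (hz.2 g)
  exact ⟨c, norm_eq_one_of_coe_eq_smul_one hd hc, hc⟩

end UnitaryRepresentations

section Transversals

variable {G H : Type*} [Group G] [Group H]

/-- `D` is the image under `U` of a transversal of the left cosets of a subgroup `N ⊇ ker U`. For
`N = ker U` this is the image of `U`, and for the preimage `N` of `Z(U)` it is a group design. -/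
structure IsCosetTransversal (D : Finset H) (U : G →* H) (N : Subgroup G) : Prop where
  ker_le : U.ker ≤ N
  mem_range : ∀ x ∈ D, x ∈ Set.range U
  existsUnique : ∀ g, ∃! x, x ∈ D ∧ ∃ n ∈ N, x = U (g * n)

namespace IsCosetTransversal

variable {D : Finset H} {U : G →* H} {N : Subgroup G}

theorem nonempty (h : IsCosetTransversal D U N) : D.Nonempty :=
  let ⟨x, hx, _⟩ := h.existsUnique 1
  ⟨x, hx.1⟩

theorem sum_out_eq [Fintype (G ⧸ N)] (h : IsCosetTransversal D U N) {M : Type*} [AddCommMonoid M]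
    (f : H → M) (hf : ∀ x, ∀ n ∈ N, f (x * U n) = f x) :
    ∑ q : G ⧸ N, f (U q.out) = ∑ x ∈ D, f x := by
  choose x hx using fun q : G ⧸ N => (h.existsUnique q.out).exists
  choose n hn hxn using fun q => (hx q).2
  refine Finset.sum_bij (fun q _ => x q) (fun q _ => (hx q).1) (fun q _ r _ hqr => ?_)
    (fun y hy => ?_) fun q _ => by rw [hxn, map_mul, hf _ _ (hn q)]
  · have hker : (q.out * n q)⁻¹ * (r.out * n r) ∈ N := h.ker_le <| by
      rw [MonoidHom.mem_ker, map_mul, map_inv, ← hxn, ← hxn, hqr, inv_mul_cancel]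
    have hqr' := QuotientGroup.eq.2 hker
    rwa [QuotientGroup.mk_mul_of_mem _ (hn q), QuotientGroup.mk_mul_of_mem _ (hn r),
      QuotientGroup.out_eq', QuotientGroup.out_eq'] at hqr'
  · obtain ⟨g, rfl⟩ := h.mem_range y hy
    obtain ⟨m, hm⟩ := QuotientGroup.mk_out_eq_mul N g
    exact ⟨QuotientGroup.mk g, Finset.mem_univ _, (h.existsUnique _).unique (hx _)
      ⟨hy, _, inv_mem m.2, by rw [hm, mul_inv_cancel_right]⟩⟩

theorem card_eq_index [Finite G] (h : IsCosetTransversal D U N) : D.card = N.index := by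
  have := Fintype.ofFinite (G ⧸ N)
  have hsum := h.sum_out_eq (fun _ => 1) fun _ _ _ => rfl
  rw [Finset.sum_const, Finset.sum_const, smul_eq_mul, smul_eq_mul, mul_one, mul_one,
    Finset.card_univ] at hsum
  rw [← hsum, Subgroup.index, Nat.card_eq_fintype_card]

theorem average_eq {k M : Type*} [Field k] [CharZero k] [AddCommGroup M] [Module k M] [Fintype G]
    (h : IsCosetTransversal D U N) (f : H → M) (hf : ∀ x, ∀ n ∈ N, f (x * U n) = f x) :
    (Nat.card G : k)⁻¹ • ∑ g, f (U g) = (D.card : k)⁻¹ • ∑ x ∈ D, f x := by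
  have := Fintype.ofFinite (G ⧸ N)
  have hN : (Nat.card N : k) ≠ 0 := Nat.cast_ne_zero.2 Nat.card_pos.ne'
  rw [sum_eq_card_smul_sum_out N (fun g => f (U g)) fun g n hn => by rw [map_mul, hf _ _ hn],
    h.sum_out_eq f hf, h.card_eq_index, ← N.card_mul_index, ← Nat.cast_smul_eq_nsmul k,
    Nat.cast_mul, mul_inv_rev, mul_smul, inv_smul_smul₀ hN]

end IsCosetTransversal

variable {d : ℕ}

theorem isCosetTransversal_matrixGroup [Finite G] (U : G →* UGroup d) :
    IsCosetTransversal (matrixGroup U) U U.ker where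
  ker_le := le_rfl
  mem_range x hx := by simpa only [matrixGroup, Set.Finite.mem_toFinset] using hx
  existsUnique g := by
    refine ⟨U g, ⟨by simp [matrixGroup], 1, one_mem _, by rw [mul_one]⟩, ?_⟩
    rintro x ⟨-, n, hn, rfl⟩
    rw [map_mul, MonoidHom.mem_ker.1 hn, mul_one]

/-- The elements of `G` whose matrices lie in the center `Z(U)`. -/
def centerPreimage (U : G →* UGroup d) : Subgroup G := (Subgroup.centralizer (Set.range U)).comap U

theorem mem_centerPreimage {U : G →* UGroup d} {n : G} :
    n ∈ centerPreimage U ↔ U n ∈ repCenter U := by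
  simp [centerPreimage, repCenter, Subgroup.mem_centralizer_iff, eq_comm]

theorem IsInducedBy.isCosetTransversal {D : Finset (UGroup d)} {U : G →* UGroup d}
    (h : IsInducedBy D U) : IsCosetTransversal D U (centerPreimage U) where
  ker_le n hn := by
    rw [mem_centerPreimage, MonoidHom.mem_ker.1 hn]
    exact ⟨⟨1, map_one U⟩, fun _ => by rw [one_mul, mul_one]⟩
  mem_range := h.1
  existsUnique g := by
    have hcoset : ∀ x, (∃ n ∈ centerPreimage U, x = U (g * n)) ↔
        ∃ z ∈ repCenter U, x = U g * z := by
      refine fun x => ⟨?_, ?_⟩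
      · rintro ⟨n, hn, rfl⟩
        exact ⟨U n, mem_centerPreimage.1 hn, map_mul _ _ _⟩
      · rintro ⟨z, hz, rfl⟩
        obtain ⟨n, rfl⟩ := hz.1
        exact ⟨n, mem_centerPreimage.2 hz, (map_mul _ _ _).symm⟩
    simpa only [hcoset] using h.2 g

end Transversals

section FramePotential

variable {d : ℕ}

/-- The matrix of the superoperator `ρ ↦ (x ⊗ x) ρ (x ⊗ x)†`, acting on vectorized operators. -/
def superoperator (x : UGroup d) :
    Matrix ((Fin d × Fin d) × Fin d × Fin d) ((Fin d × Fin d) × Fin d × Fin d) ℂ :=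
  tensorSq x ⊗ₖ (tensorSq x).map star

theorem tensorSq_mul (x y : UGroup d) : tensorSq (x * y) = tensorSq x * tensorSq y :=
  Matrix.mul_kronecker_mul _ _ _ _

theorem tensorSq_inv (x : UGroup d) : tensorSq x⁻¹ = (tensorSq x)ᴴ :=
  (Matrix.conjTranspose_kronecker _ _).symm

theorem superoperator_mul (x y : UGroup d) :
    superoperator (x * y) = superoperator x * superoperator y := by
  rw [superoperator, tensorSq_mul, superoperator, superoperator, ← Matrix.mul_kronecker_mul]
  congr 1
  exact Matrix.map_mul (f := starRingEnd ℂ)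

theorem superoperator_inv (x : UGroup d) : superoperator x⁻¹ = (superoperator x)ᴴ := by
  rw [superoperator, tensorSq_inv, superoperator, Matrix.conjTranspose_kronecker]
  rfl

theorem trace_superoperator (x : UGroup d) :
    (superoperator x).trace = ‖(x : Matrix (Fin d) (Fin d) ℂ).trace‖ ^ 4 := by
  have hconj : ((tensorSq x).map star).trace = conj (tensorSq x).trace :=
    (AddMonoidHom.map_trace (starRingEnd ℂ) (tensorSq x)).symm
  rw [superoperator, Matrix.trace_kronecker, hconj, Complex.mul_conj', tensorSq,
    Matrix.trace_kronecker, norm_mul]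
  push_cast
  ring

theorem superoperator_mul_eq_of_coe_eq_smul_one (x : UGroup d) {z : UGroup d} {c : ℂ}
    (hc : ‖c‖ = 1) (hz : (z : Matrix (Fin d) (Fin d) ℂ) = c • 1) :
    superoperator (x * z) = superoperator x := by
  have hcoe : ((x * z : UGroup d) : Matrix (Fin d) (Fin d) ℂ) = c • x.1 := by
    rw [Submonoid.coe_mul, hz, mul_smul_comm, mul_one]
  have hconj : conj c * c = 1 := by rw [Complex.conj_mul', hc]; norm_num
  ext ⟨i, j⟩ ⟨k, l⟩
  simp only [superoperator, tensorSq, hcoe, Matrix.kroneckerMap_apply, Matrix.map_apply,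
    Matrix.smul_apply, smul_eq_mul, RCLike.star_def, map_mul]
  linear_combination (conj c * c + 1) * x.1 i.1 k.1 * x.1 i.2 k.2 *
    (conj (x.1 j.1 l.1) * conj (x.1 j.2 l.2)) * hconj

/-- The matrix of the twirl `ρ ↦ |D|⁻¹ ∑_x (x ⊗ x) ρ (x ⊗ x)†` over `D`. -/
noncomputable def twirlMatrix (D : Finset (UGroup d)) :
    Matrix ((Fin d × Fin d) × Fin d × Fin d) ((Fin d × Fin d) × Fin d × Fin d) ℂ :=
  (D.card : ℂ)⁻¹ • ∑ x ∈ D, superoperator x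

theorem framePotential_eq_trace (D : Finset (UGroup d)) :
    (framePotential D : ℂ) = ((twirlMatrix D)ᴴ * twirlMatrix D).trace := by
  have hterm : ∀ x y : UGroup d, ((superoperator x)ᴴ * superoperator y).trace =
      (‖((x : Matrix (Fin d) (Fin d) ℂ)ᴴ * (y : Matrix (Fin d) (Fin d) ℂ)).trace‖ ^ 4 : ℝ) := by
    intro x y
    rw [← superoperator_inv, ← superoperator_mul, trace_superoperator, Complex.ofReal_pow]
    rfl
  simp only [twirlMatrix, Matrix.conjTranspose_smul, Matrix.conjTranspose_sum, Matrix.smul_mul,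
    Matrix.mul_smul, Matrix.trace_smul, Finset.sum_mul_sum, Matrix.trace_sum, hterm,
    star_inv₀, star_natCast, smul_eq_mul]
  rw [framePotential]
  push_cast
  rw [← mul_assoc, ← mul_inv, ← sq, div_eq_inv_mul]

variable {G : Type*} [Group G]

/-- The matrix of the twirl over all `U_g`, repeated elements being counted with multiplicity. -/
noncomputable def groupTwirlMatrix [Fintype G] (U : G →* UGroup d) :
    Matrix ((Fin d × Fin d) × Fin d × Fin d) ((Fin d × Fin d) × Fin d × Fin d) ℂ :=
  (Nat.card G : ℂ)⁻¹ • ∑ g, superoperator (U g)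

theorem superoperator_mul_groupTwirlMatrix [Fintype G] (U : G →* UGroup d) (g : G) :
    superoperator (U g) * groupTwirlMatrix U = groupTwirlMatrix U := by
  rw [groupTwirlMatrix, mul_smul_comm, Finset.mul_sum]
  congr 1
  exact Fintype.sum_equiv (Equiv.mulLeft g) _ _ fun h => by
    rw [← superoperator_mul, ← map_mul]; rfl

theorem conjTranspose_twirlMatrix_mul_groupTwirlMatrix [Fintype G] {U : G →* UGroup d}
    {D : Finset (UGroup d)} (hne : D.Nonempty) (hD : ∀ x ∈ D, x ∈ Set.range U) :
    (twirlMatrix D)ᴴ * groupTwirlMatrix U = groupTwirlMatrix U := by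
  have hterm : ∀ x ∈ D, (superoperator x)ᴴ * groupTwirlMatrix U = groupTwirlMatrix U := by
    intro x hx
    obtain ⟨g, rfl⟩ := hD x hx
    rw [← superoperator_inv, ← map_inv, superoperator_mul_groupTwirlMatrix]
  rw [twirlMatrix, Matrix.conjTranspose_smul, Matrix.conjTranspose_sum, smul_mul_assoc,
    Finset.sum_mul, Finset.sum_congr rfl hterm, Finset.sum_const, star_inv₀, star_natCast,
    ← Nat.cast_smul_eq_nsmul ℂ, inv_smul_smul₀ (Nat.cast_ne_zero.2 hne.card_ne_zero)]

theorem trace_groupTwirlMatrix [Fintype G] (U : G →* UGroup d) :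
    (groupTwirlMatrix U).trace = charPairing (rep2 U).character (rep2 U).character := by
  rw [groupTwirlMatrix, Matrix.trace_smul, Matrix.trace_sum, smul_eq_mul, charPairing]
  refine congrArg _ (Finset.sum_congr rfl fun g _ => ?_)
  rw [trace_superoperator, character_rep2_inv, Complex.mul_conj', character_rep2, character_rep,
    norm_pow]
  push_cast
  ring

theorem IsCosetTransversal.twirlMatrix_eq [Fintype G] {D : Finset (UGroup d)}
    {U : G →* UGroup d} {N : Subgroup G} (h : IsCosetTransversal D U N)
    (hN : ∀ n ∈ N, ∃ c : ℂ, ‖c‖ = 1 ∧ (U n : Matrix (Fin d) (Fin d) ℂ) = c • 1) :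
    twirlMatrix D = groupTwirlMatrix U :=
  (h.average_eq _ fun x n hn =>
    let ⟨_, hc, hz⟩ := hN n hn; superoperator_mul_eq_of_coe_eq_smul_one x hc hz).symm

theorem twirlMatrix_matrixGroup [Fintype G] (U : G →* UGroup d) :
    twirlMatrix (matrixGroup U) = groupTwirlMatrix U :=
  (isCosetTransversal_matrixGroup U).twirlMatrix_eq fun n hn =>
    ⟨1, norm_one, by rw [MonoidHom.mem_ker.1 hn, one_smul]; rfl⟩

theorem IsInducedBy.twirlMatrix_eq [Fintype G] (hd : 1 ≤ d) {D : Finset (UGroup d)}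
    {U : G →* UGroup d} (h : IsInducedBy D U) (hU : (rep U).IsIrreducible) :
    twirlMatrix D = groupTwirlMatrix U :=
  h.isCosetTransversal.twirlMatrix_eq fun _ hn =>
    exists_coe_eq_smul_one_of_mem_repCenter hd hU (mem_centerPreimage.1 hn)

theorem conjTranspose_groupTwirlMatrix_mul_self [Fintype G] (U : G →* UGroup d) :
    (groupTwirlMatrix U)ᴴ * groupTwirlMatrix U = groupTwirlMatrix U := by
  have hM := isCosetTransversal_matrixGroup U
  nth_rw 1 [← twirlMatrix_matrixGroup]
  exact conjTranspose_twirlMatrix_mul_groupTwirlMatrix hM.nonempty hM.mem_range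

theorem framePotential_eq_charPairing [Fintype G] {D : Finset (UGroup d)} {U : G →* UGroup d}
    (h : twirlMatrix D = groupTwirlMatrix U) :
    (framePotential D : ℂ) = charPairing (rep2 U).character (rep2 U).character := by
  rw [framePotential_eq_trace, h, conjTranspose_groupTwirlMatrix_mul_self, trace_groupTwirlMatrix]

theorem exists_framePotential_eq_intCast [Fintype G] {D : Finset (UGroup d)} {U : G →* UGroup d}
    (h : twirlMatrix D = groupTwirlMatrix U) : ∃ m : ℤ, framePotential D = m :=
  ⟨finrank ℂ (IntertwiningMap (rep2 U) (rep2 U)), by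
    exact_mod_cast
      (framePotential_eq_charPairing h).trans (charPairing_character (rep2 U) (rep2 U))⟩

open scoped ComplexOrder in
-- With `E` the twirl over the group and `A` the one over `D`, `0 ≤ tr (A - E)†(A - E)` and
-- `A†E = E = E†E`.
theorem framePotential_matrixGroup_le [Finite G] (U : G →* UGroup d) {D : Finset (UGroup d)}
    (hne : D.Nonempty) (hD : ∀ x ∈ D, x ∈ Set.range U) :
    framePotential (matrixGroup U) ≤ framePotential D := by
  have := Fintype.ofFinite G
  have hEE := conjTranspose_groupTwirlMatrix_mul_self U
  have hAE := conjTranspose_twirlMatrix_mul_groupTwirlMatrix hne hD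
  have hpot : (framePotential (matrixGroup U) : ℂ) = (groupTwirlMatrix U).trace := by
    rw [framePotential_eq_trace, twirlMatrix_matrixGroup, hEE]
  generalize groupTwirlMatrix U = E at hEE hAE hpot
  set A := twirlMatrix D
  have hE : Eᴴ = E := by
    rw [← hEE, Matrix.conjTranspose_mul, Matrix.conjTranspose_conjTranspose]
  have hEA : Eᴴ * A = E := by
    rw [← Matrix.conjTranspose_conjTranspose A, ← Matrix.conjTranspose_mul, hAE, hE]
  have hdiff : (A - E)ᴴ * (A - E) = Aᴴ * A - E := by
    rw [Matrix.conjTranspose_sub, sub_mul, mul_sub, mul_sub, hAE, hEA, hEE, sub_self, sub_zero]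
  have hnonneg := (Matrix.posSemidef_conjTranspose_mul_self (A - E)).trace_nonneg
  rw [hdiff, Matrix.trace_sub, ← framePotential_eq_trace, ← hpot, sub_nonneg] at hnonneg
  exact Complex.real_le_real.1 hnonneg

end FramePotential

section SchurWeyl

variable {d : ℕ}

/-- The matrix of the swap `x ⊗ y ↦ y ⊗ x` of `ℂ^d ⊗ ℂ^d`. -/
def swapMatrix (d : ℕ) : Matrix (Fin d × Fin d) (Fin d × Fin d) ℂ :=
  (1 : Matrix (Fin d × Fin d) (Fin d × Fin d) ℂ).submatrix Prod.swap id

theorem swapMatrix_apply (p q : Fin d × Fin d) :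
    swapMatrix d p q = if p.swap = q then 1 else 0 := by
  simp [swapMatrix, Matrix.one_apply]

theorem swapMatrix_mul_apply (X : Matrix (Fin d × Fin d) (Fin d × Fin d) ℂ) (p q : Fin d × Fin d) :
    (swapMatrix d * X) p q = X p.swap q := by
  simp [Matrix.mul_apply, swapMatrix_apply]

theorem mul_swapMatrix_apply (X : Matrix (Fin d × Fin d) (Fin d × Fin d) ℂ) (p q : Fin d × Fin d) :
    (X * swapMatrix d) p q = X p q.swap := by
  simp [Matrix.mul_apply, swapMatrix_apply, Prod.swap_eq_iff_eq_swap]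

theorem tensorSq_apply (V : UGroup d) (p q : Fin d × Fin d) :
    tensorSq V p q =
      (V : Matrix (Fin d) (Fin d) ℂ) p.1 q.1 * (V : Matrix (Fin d) (Fin d) ℂ) p.2 q.2 :=
  rfl

theorem tensorSq_mul_swapMatrix (V : UGroup d) :
    tensorSq V * swapMatrix d = swapMatrix d * tensorSq V := by
  ext p q
  rw [mul_swapMatrix_apply, swapMatrix_mul_apply, tensorSq_apply, tensorSq_apply, mul_comm]
  rfl

theorem apply_eq_zero_of_commute_diagonal {X : Matrix (Fin d × Fin d) (Fin d × Fin d) ℂ}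
    (hX : ∀ V : UGroup d, tensorSq V * X = X * tensorSq V) {p q : Fin d × Fin d}
    (hne : p ≠ q) (hswap : p ≠ q.swap) : X p q = 0 := by
  -- These phases are chosen so that `t p.1 * t p.2 = t k * t l` forces `{k, l} = {p.1, p.2}`.
  let t : Fin d → ℂ := fun m => if m = p.2 then Complex.I else if m = p.1 then -1 else 1
  have ht : Matrix.diagonal t ∈ Matrix.unitaryGroup (Fin d) ℂ := by
    rw [Matrix.mem_unitaryGroup_iff, Matrix.star_eq_conjTranspose,
      Matrix.diagonal_conjTranspose, Matrix.diagonal_mul_diagonal, ← Matrix.diagonal_one]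
    congr 1
    ext m
    simp only [t, Pi.star_apply]
    split_ifs <;> simp
  have hentry : t p.1 * t p.2 * X p q = X p q * (t q.1 * t q.2) := by
    have hdiag : tensorSq ⟨_, ht⟩ = Matrix.diagonal fun p => t p.1 * t p.2 :=
      Matrix.diagonal_kronecker_diagonal _ _
    have h := congrFun (congrFun (hX ⟨_, ht⟩) p) q
    rwa [hdiag, Matrix.diagonal_mul, Matrix.mul_diagonal] at h
  have hphase : t p.1 * t p.2 ≠ t q.1 * t q.2 := by
    have hI : Complex.I ≠ 1 ∧ Complex.I ≠ -1 ∧ -Complex.I ≠ 1 ∧ -Complex.I ≠ -1 ∧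
      Complex.I ≠ -Complex.I := by
      norm_num [Complex.ext_iff]
    obtain ⟨i, j⟩ := p
    obtain ⟨k, l⟩ := q
    simp only [t]
    grind [Complex.I_mul_I]
  exact (mul_eq_mul_left_iff.1 (by rwa [mul_comm] at hentry)).resolve_left hphase

theorem apply_perm_of_commute {X : Matrix (Fin d × Fin d) (Fin d × Fin d) ℂ}
    (hX : ∀ V : UGroup d, tensorSq V * X = X * tensorSq V) (σ : Equiv.Perm (Fin d))
    (i j k l : Fin d) : X (σ i, σ j) (σ k, σ l) = X (i, j) (k, l) := by
  have hσ : σ.permMatrix ℂ ∈ Matrix.unitaryGroup (Fin d) ℂ := by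
    rw [Matrix.mem_unitaryGroup_iff, Matrix.star_eq_conjTranspose, Matrix.conjTranspose_permMatrix,
      ← Matrix.permMatrix_mul, inv_mul_cancel, Matrix.permMatrix_one]
  have h := congrFun (congrFun (hX ⟨_, hσ⟩) (i, j)) (σ k, σ l)
  simpa [Matrix.mul_apply, Fintype.sum_prod_type, tensorSq_apply, Equiv.Perm.permMatrix,
    PEquiv.toMatrix_apply, ite_and, ← Finset.sum_mul, ← Finset.mul_sum] using h

theorem one_add_smul_ones_mem_unitaryGroup {c : ℂ} (hc : c + conj c + c * conj c * d = 0) :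
    1 + c • Matrix.of (fun _ _ => 1) ∈ Matrix.unitaryGroup (Fin d) ℂ := by
  rw [Matrix.mem_unitaryGroup_iff]
  ext i j
  simp only [Matrix.mul_apply, Matrix.star_apply, Matrix.add_apply, Matrix.smul_apply,
    Matrix.one_apply, Matrix.of_apply, smul_eq_mul, mul_one, RCLike.star_def, map_add, apply_ite,
    map_one, map_zero, add_mul, mul_add, Finset.sum_add_distrib, ite_mul, one_mul, zero_mul,
    mul_zero, Finset.sum_ite_eq, Finset.mem_univ, if_true, Finset.sum_const,
    Finset.card_univ, Fintype.card_fin, nsmul_eq_mul]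
  split_ifs <;> linear_combination hc

theorem exists_unitary_apply_ne_zero (d : ℕ) :
    ∃ W : UGroup d, ∀ i j, (W : Matrix (Fin d) (Fin d) ℂ) i j ≠ 0 := by
  obtain rfl | hd := eq_or_ne d 0
  · exact ⟨1, fun i => i.elim0⟩
  have hd' : (d : ℂ) ≠ 0 := Nat.cast_ne_zero.2 hd
  have hunitary := one_add_smul_ones_mem_unitaryGroup (d := d) (c := (Complex.I - 1) / d) <| by
    simp only [map_div₀, map_sub, Complex.conj_I, map_one, map_natCast]
    field_simp
    linear_combination (-1 : ℂ) * Complex.I_sq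
  refine ⟨⟨_, hunitary⟩, fun i j h => ?_⟩
  have him := congrArg Complex.im h
  rcases eq_or_ne i j with rfl | hij
  · simp [Complex.div_natCast_im, hd] at him
  · simp [Complex.div_natCast_im, hij, hd] at him

-- Compare the entries at `((i, i), (i, j))` of `(W ⊗ W) X = X (W ⊗ W)`, where no entry of `W`
-- vanishes.
theorem apply_self_eq_add_of_commute {X : Matrix (Fin d × Fin d) (Fin d × Fin d) ℂ}
    (hX : ∀ V : UGroup d, tensorSq V * X = X * tensorSq V) {i j : Fin d} (hij : i ≠ j) :
    X (i, i) (i, i) = X (i, j) (i, j) + X (j, i) (i, j) := by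
  obtain ⟨W, hW⟩ := exists_unitary_apply_ne_zero d
  have hleft : (tensorSq W * X) (i, i) (i, j) =
      W.1 i i * W.1 i j * (X (i, j) (i, j) + X (j, i) (i, j)) := by
    rw [Matrix.mul_apply, Fintype.sum_eq_add (i, j) (j, i) (by simp [hij]), tensorSq_apply,
      tensorSq_apply]
    · ring
    · rintro p ⟨hp, hp'⟩
      rw [apply_eq_zero_of_commute_diagonal hX hp hp', mul_zero]
  have hright : (X * tensorSq W) (i, i) (i, j) = W.1 i i * W.1 i j * X (i, i) (i, i) := by
    rw [Matrix.mul_apply, Fintype.sum_eq_single (i, i), tensorSq_apply, mul_comm]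
    intro p hp
    rw [apply_eq_zero_of_commute_diagonal hX hp.symm, zero_mul]
    exact fun h => hp (Prod.swap_injective h.symm)
  exact mul_left_cancel₀ (mul_ne_zero (hW i i) (hW i j)) (by rw [← hright, ← hleft, hX])

theorem exists_eq_smul_add_smul_swapMatrix {X : Matrix (Fin d × Fin d) (Fin d × Fin d) ℂ}
    (hX : ∀ V : UGroup d, tensorSq V * X = X * tensorSq V) :
    ∃ a b : ℂ, X = a • 1 + b • swapMatrix d := by
  rcases subsingleton_or_nontrivial (Fin d) with _ | _
  · refine ⟨X.trace, 0, ?_⟩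
    ext p q
    obtain rfl := Subsingleton.elim p q
    simp [Matrix.trace, Fintype.sum_subsingleton _ p]
  obtain ⟨m, n, hmn⟩ := exists_pair_ne (Fin d)
  have hoffdiag : ∀ {i j : Fin d}, i ≠ j → X (i, j) (i, j) = X (m, n) (m, n) ∧
      X (j, i) (i, j) = X (n, m) (m, n) := by
    intro i j hij
    obtain ⟨σ, rfl, rfl⟩ := MulAction.is_two_pretransitive_iff.1
      (Equiv.Perm.isMultiplyPretransitive (Fin d) 2) hmn hij
    exact ⟨apply_perm_of_commute hX σ _ _ _ _, apply_perm_of_commute hX σ _ _ _ _⟩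
  refine ⟨X (m, n) (m, n), X (n, m) (m, n), ?_⟩
  ext ⟨i, j⟩ ⟨k, l⟩
  simp only [Matrix.add_apply, Matrix.smul_apply, smul_eq_mul, swapMatrix_apply, Matrix.one_apply,
    Prod.swap_prod_mk, mul_ite, mul_one, mul_zero]
  by_cases hne : (i, j) = (k, l)
  · obtain ⟨rfl, rfl⟩ := Prod.mk.inj hne
    rcases eq_or_ne i j with rfl | hij
    · obtain ⟨r, hr⟩ := exists_ne i
      simp [apply_self_eq_add_of_commute hX hr.symm, hoffdiag hr.symm]
    · simp [hij.symm, hoffdiag hij]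
  by_cases hswap : (j, i) = (k, l)
  · obtain ⟨rfl, rfl⟩ := Prod.mk.inj hswap
    simp [hne, hoffdiag (show j ≠ i by rintro rfl; exact hne rfl)]
  · rw [if_neg hne, if_neg hswap, add_zero, apply_eq_zero_of_commute_diagonal hX hne]
    exact fun h => hswap (congrArg Prod.swap h)

-- Taking the partial trace over the second factor gives `d A = (d a + b) 1`.
theorem exists_eq_smul_one_of_kronecker_one {A : Matrix (Fin d) (Fin d) ℂ} {a b : ℂ}
    (h : A ⊗ₖ (1 : Matrix (Fin d) (Fin d) ℂ) = a • 1 + b • swapMatrix d) :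
    ∃ c : ℂ, A = c • 1 := by
  refine ⟨a + b / d, ?_⟩
  ext i j
  have hd : (d : ℂ) ≠ 0 := Nat.cast_ne_zero.2 (Fin.pos i).ne'
  have htrace := Finset.sum_congr rfl fun (k : Fin d) (_ : k ∈ Finset.univ) =>
    congrFun (congrFun h (i, k)) (j, k)
  refine mul_left_cancel₀ hd ?_
  rcases eq_or_ne i j with rfl | hij
  · simpa [swapMatrix_apply, Matrix.one_apply, ite_and, Finset.sum_add_distrib, mul_add,
      mul_div_cancel₀ _ hd] using htrace
  · simpa [swapMatrix_apply, Matrix.one_apply, ite_and, hij] using htrace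

end SchurWeyl

section HaarTwirl

variable {d : ℕ}

theorem tensorSq_conj_apply (V : UGroup d) (X : Matrix (Fin d × Fin d) (Fin d × Fin d) ℂ)
    (p q : Fin d × Fin d) :
    (tensorSq V * X * (tensorSq V)ᴴ) p q = ∑ r, superoperator V (p, q) r * X r.1 r.2 := by
  simp only [Matrix.mul_apply, Finset.sum_mul, Fintype.sum_prod_type_right, superoperator,
    Matrix.kroneckerMap_apply, Matrix.map_apply, Matrix.conjTranspose_apply, mul_right_comm]

theorem tensorSq_mul_mul_conjTranspose_eq_iff (V : UGroup d)
    (X : Matrix (Fin d × Fin d) (Fin d × Fin d) ℂ) :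
    tensorSq V * X * (tensorSq V)ᴴ = X ↔ tensorSq V * X = X * tensorSq V := by
  have hone : tensorSq (1 : UGroup d) = 1 := Matrix.one_kronecker_one
  have hleft : (tensorSq V)ᴴ * tensorSq V = 1 := by
    rw [← tensorSq_inv, ← tensorSq_mul, inv_mul_cancel, hone]
  have hright : tensorSq V * (tensorSq V)ᴴ = 1 := by
    rw [← tensorSq_inv, ← tensorSq_mul, mul_inv_cancel, hone]
  refine ⟨fun h => ?_, fun h => ?_⟩
  · nth_rewrite 2 [← h]
    rw [mul_assoc _ _ (tensorSq V), hleft, mul_one]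
  · rw [h, mul_assoc, hright, mul_one]

instance : (haarU d).IsHaarMeasure :=
  inferInstanceAs (Measure.haarMeasure ⊤).IsHaarMeasure

instance : (haarU d).IsMulRightInvariant where
  map_mul_right_eq_self g := by
    have : IsProbabilityMeasure ((haarU d).map (· * g)) :=
      Measure.isProbabilityMeasure_map (measurable_mul_const g).aemeasurable
    exact Measure.isHaarMeasure_eq_of_isProbabilityMeasure _ _

theorem integrable_tensorSq_conj_apply (X : Matrix (Fin d × Fin d) (Fin d × Fin d) ℂ)
    (p q : Fin d × Fin d) :
    Integrable (fun V : UGroup d => (tensorSq V * X * (tensorSq V)ᴴ) p q) (haarU d) := by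
  refine Continuous.integrable_of_hasCompactSupport ?_ (HasCompactSupport.of_compactSpace _)
  have hentry : ∀ i j, Continuous fun V : UGroup d => (V : Matrix (Fin d) (Fin d) ℂ) i j :=
    fun i j => continuous_subtype_val.matrix_elem i j
  simp only [Matrix.mul_apply, tensorSq_apply, Matrix.conjTranspose_apply]
  exact continuous_finsetSum _ fun j _ => (continuous_finsetSum _ fun k _ =>
    ((hentry _ _).mul (hentry _ _)).mul continuous_const).mul
      ((hentry _ _).mul (hentry _ _)).star

/-- The average of `(V ⊗ V) X (V ⊗ V)†` over the unitary group, as a linear map in `X`. -/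
noncomputable def haarTwirl (d : ℕ) :
    Matrix (Fin d × Fin d) (Fin d × Fin d) ℂ →ₗ[ℂ] Matrix (Fin d × Fin d) (Fin d × Fin d) ℂ where
  toFun X := Matrix.of fun p q => ∫ V : UGroup d, (tensorSq V * X * (tensorSq V)ᴴ) p q ∂(haarU d)
  map_add' X Y := by
    ext p q
    simp only [Matrix.of_apply, Matrix.add_apply, mul_add, add_mul]
    exact integral_add (integrable_tensorSq_conj_apply X p q) (integrable_tensorSq_conj_apply Y p q)
  map_smul' c X := by
    ext p q
    simp only [Matrix.of_apply, Matrix.smul_apply, Matrix.mul_smul, Matrix.smul_mul]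
    exact integral_const_mul c _

theorem haarTwirl_apply (X : Matrix (Fin d × Fin d) (Fin d × Fin d) ℂ) (p q : Fin d × Fin d) :
    haarTwirl d X p q = ∫ V : UGroup d, (tensorSq V * X * (tensorSq V)ᴴ) p q ∂(haarU d) :=
  rfl

theorem tensorSq_mul_haarTwirl (W : UGroup d) (X : Matrix (Fin d × Fin d) (Fin d × Fin d) ℂ) :
    tensorSq W * haarTwirl d X = haarTwirl d X * tensorSq W := by
  rw [← tensorSq_mul_mul_conjTranspose_eq_iff]
  ext p q
  have hmul : ∀ V : UGroup d, (tensorSq (W * V) * X * (tensorSq (W * V))ᴴ) p q =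
      ∑ r, superoperator W (p, q) r * (tensorSq V * X * (tensorSq V)ᴴ) r.1 r.2 := by
    intro V
    rw [← tensorSq_conj_apply, tensorSq_mul, Matrix.conjTranspose_mul]
    simp only [mul_assoc]
  rw [haarTwirl_apply, tensorSq_conj_apply, ← integral_mul_left_eq_self _ W]
  simp only [hmul]
  rw [integral_finsetSum _ fun r _ => (integrable_tensorSq_conj_apply X r.1 r.2).const_mul _]
  simp only [integral_const_mul, haarTwirl_apply]

theorem haarTwirl_tensorSq_conj (W : UGroup d) (X : Matrix (Fin d × Fin d) (Fin d × Fin d) ℂ) :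
    haarTwirl d (tensorSq W * X * (tensorSq W)ᴴ) = haarTwirl d X := by
  ext p q
  rw [haarTwirl_apply, haarTwirl_apply,
    ← integral_mul_right_eq_self (fun V : UGroup d => (tensorSq V * X * (tensorSq V)ᴴ) p q) W]
  simp only [tensorSq_mul, Matrix.conjTranspose_mul, mul_assoc]

theorem haarTwirl_eq_self {X : Matrix (Fin d × Fin d) (Fin d × Fin d) ℂ}
    (hX : ∀ V : UGroup d, tensorSq V * X = X * tensorSq V) : haarTwirl d X = X := by
  ext p q
  simp only [haarTwirl_apply, (tensorSq_mul_mul_conjTranspose_eq_iff _ X).2 (hX _),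
    integral_const, probReal_univ, one_smul]

end HaarTwirl

section Commutant

variable {G : Type*} [Group G] {d : ℕ}

/-- The commutant of `U^(2)`, in matrix form. -/
def tensorSqCommutant (U : G →* UGroup d) :
    Submodule ℂ (Matrix (Fin d × Fin d) (Fin d × Fin d) ℂ) where
  carrier := {X | ∀ g, tensorSq (U g) * X = X * tensorSq (U g)}
  zero_mem' g := by rw [mul_zero, zero_mul]
  add_mem' hX hY g := by rw [mul_add, add_mul, hX g, hY g]
  smul_mem' c X hX g := by rw [mul_smul_comm, smul_mul_assoc, hX g]

theorem toMatrix_rep2 (U : G →* UGroup d) (g : G) :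
    LinearMap.toMatrix ((Pi.basisFun ℂ (Fin d)).tensorProduct (Pi.basisFun ℂ (Fin d)))
      ((Pi.basisFun ℂ (Fin d)).tensorProduct (Pi.basisFun ℂ (Fin d))) (rep2 U g) =
      tensorSq (U g) := by
  change LinearMap.toMatrix _ _ (TensorProduct.map _ _) = _
  rw [TensorProduct.toMatrix_map]
  change Matrix.kroneckerMap _ (LinearMap.toMatrix' (Matrix.toLin' _))
    (LinearMap.toMatrix' (Matrix.toLin' _)) = _
  rw [LinearMap.toMatrix'_toLin']
  rfl

theorem finrank_tensorSqCommutant (U : G →* UGroup d) :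
    finrank ℂ (tensorSqCommutant U) = finrank ℂ (IntertwiningMap (rep2 U) (rep2 U)) := by
  let b := (Pi.basisFun ℂ (Fin d)).tensorProduct (Pi.basisFun ℂ (Fin d))
  let e := LinearMap.toMatrix b b
  have hcomm : ∀ f, e f ∈ tensorSqCommutant U ↔ ∀ g, rep2 U g ∘ₗ f = f ∘ₗ rep2 U g := fun f => by
    refine forall_congr' fun g => ?_
    rw [← toMatrix_rep2, ← LinearMap.toMatrix_comp, ← LinearMap.toMatrix_comp, e.injective.eq_iff]
  let φ : IntertwiningMap (rep2 U) (rep2 U) ≃ₗ[ℂ] tensorSqCommutant U :=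
    { toFun := fun f => ⟨e f.toLinearMap, (hcomm _).2 fun g => (f.isIntertwining' g).symm⟩
      map_add' := fun f f' => Subtype.ext (map_add e _ _)
      map_smul' := fun c f => Subtype.ext (map_smul e c _)
      invFun := fun X => ⟨e.symm X, fun g => ((hcomm _).1 (by
        rw [LinearEquiv.apply_symm_apply]; exact X.2) g).symm⟩
      left_inv := fun f => IntertwiningMap.ext (e.symm_apply_apply _)
      right_inv := fun X => Subtype.ext (e.apply_symm_apply _) }
  exact φ.finrank_eq.symm

theorem charInner_rep2_eq_finrank [Fintype G] (U : G →* UGroup d) :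
    charInner (rep2 U).character (rep2 U).character = finrank ℂ (tensorSqCommutant U) := by
  rw [charInner_rep2, charPairing_character, finrank_tensorSqCommutant]

theorem linearIndependent_one_swapMatrix (hd : 2 ≤ d) :
    LinearIndependent ℂ ![1, swapMatrix d] := by
  have := Fin.nontrivial_iff_two_le.2 hd
  obtain ⟨i, j, hij⟩ := exists_pair_ne (Fin d)
  refine LinearIndependent.pair_iff.2 fun a b h => ⟨?_, ?_⟩
  · simpa [swapMatrix_apply, hij.symm] using congrFun (congrFun h (i, j)) (i, j)
  · simpa [swapMatrix_apply, Matrix.one_apply, hij] using congrFun (congrFun h (i, j)) (j, i)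

theorem span_one_swapMatrix_le_tensorSqCommutant (U : G →* UGroup d) :
    Submodule.span ℂ {1, swapMatrix d} ≤ tensorSqCommutant U :=
  Submodule.span_le.2 <| Set.pair_subset (fun g => by rw [mul_one, one_mul])
    fun g => tensorSq_mul_swapMatrix (U g)

theorem tensorSqCommutant_id (d : ℕ) :
    tensorSqCommutant (MonoidHom.id (UGroup d)) = Submodule.span ℂ {1, swapMatrix d} := by
  refine le_antisymm (fun X hX => Submodule.mem_span_pair.2 ?_)
    (span_one_swapMatrix_le_tensorSqCommutant _)
  obtain ⟨a, b, h⟩ := exists_eq_smul_add_smul_swapMatrix hX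
  exact ⟨a, b, h.symm⟩

theorem finrank_tensorSqCommutant_eq_two_iff (hd : 2 ≤ d) (U : G →* UGroup d) :
    finrank ℂ (tensorSqCommutant U) = 2 ↔
      tensorSqCommutant U = Submodule.span ℂ {1, swapMatrix d} := by
  have hspan : finrank ℂ (Submodule.span ℂ {1, swapMatrix d}) = 2 := by
    rw [← Matrix.range_cons_cons_empty _ _ ![],
      finrank_span_eq_card (linearIndependent_one_swapMatrix hd), Fintype.card_fin]
  refine ⟨fun h => ?_, fun h => h ▸ hspan⟩
  exact (Submodule.eq_of_le_of_finrank_eq (span_one_swapMatrix_le_tensorSqCommutant U)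
    (hspan.trans h.symm)).symm

theorem isIrreducible_of_tensorSqCommutant [Finite G] (hd : 1 ≤ d) {U : G →* UGroup d}
    (h : tensorSqCommutant U = Submodule.span ℂ {1, swapMatrix d}) : (rep U).IsIrreducible := by
  refine isIrreducible_rep_of_forall_commute hd fun A hA => ?_
  have hmem : A ⊗ₖ (1 : Matrix (Fin d) (Fin d) ℂ) ∈ tensorSqCommutant U := fun g => by
    rw [tensorSq, ← Matrix.mul_kronecker_mul, ← Matrix.mul_kronecker_mul, hA, one_mul, mul_one]
  obtain ⟨a, b, hab⟩ := Submodule.mem_span_pair.1 (h ▸ hmem)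
  exact exists_eq_smul_one_of_kronecker_one hab.symm

theorem IsUnitaryTwoDesign.tensorSqCommutant_eq {D : Finset (UGroup d)}
    (h : IsUnitaryTwoDesign D) {U : G →* UGroup d} (hD : ∀ x ∈ D, x ∈ Set.range U) :
    tensorSqCommutant U = Submodule.span ℂ {1, swapMatrix d} := by
  refine le_antisymm (fun X hX => ?_) (span_one_swapMatrix_le_tensorSqCommutant U)
  have hfix : haarTwirl d X = X := by
    ext p q
    have hterm : ∀ x ∈ D, (tensorSq x * X * (tensorSq x)ᴴ) p q = X p q := fun x hx => by
      obtain ⟨g, rfl⟩ := hD x hx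
      rw [(tensorSq_mul_mul_conjTranspose_eq_iff _ _).2 (hX g)]
    rw [haarTwirl_apply, ← h.2 X p q, Finset.sum_congr rfl hterm, Finset.sum_const, nsmul_eq_mul,
      inv_mul_cancel_left₀ (Nat.cast_ne_zero.2 h.1.card_ne_zero)]
  rw [← tensorSqCommutant_id, ← hfix]
  exact fun V => tensorSq_mul_haarTwirl V X

theorem average_tensorSq_conj_mem_tensorSqCommutant [Fintype G] (U : G →* UGroup d)
    (X : Matrix (Fin d × Fin d) (Fin d × Fin d) ℂ) :
    (Nat.card G : ℂ)⁻¹ • ∑ g, tensorSq (U g) * X * (tensorSq (U g))ᴴ ∈ tensorSqCommutant U := by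
  refine Submodule.smul_mem _ _ fun g => ?_
  rw [← tensorSq_mul_mul_conjTranspose_eq_iff, Finset.mul_sum, Finset.sum_mul]
  refine Fintype.sum_equiv (Equiv.mulLeft g) _ _ fun h => ?_
  rw [Equiv.coe_mulLeft, map_mul, tensorSq_mul, Matrix.conjTranspose_mul]
  simp only [mul_assoc]

theorem haarTwirl_eq_average [Fintype G] {U : G →* UGroup d}
    (h : tensorSqCommutant U = Submodule.span ℂ {1, swapMatrix d})
    (X : Matrix (Fin d × Fin d) (Fin d × Fin d) ℂ) :
    haarTwirl d X = (Nat.card G : ℂ)⁻¹ • ∑ g, tensorSq (U g) * X * (tensorSq (U g))ᴴ := by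
  have hmem := average_tensorSq_conj_mem_tensorSqCommutant U X
  rw [h, ← tensorSqCommutant_id] at hmem
  rw [← haarTwirl_eq_self hmem, map_smul, map_sum]
  simp only [haarTwirl_tensorSq_conj]
  rw [Finset.sum_const, Finset.card_univ, Fintype.card_eq_nat_card, ← Nat.cast_smul_eq_nsmul ℂ,
    inv_smul_smul₀ (Nat.cast_ne_zero.2 Nat.card_pos.ne')]

theorem IsInducedBy.isUnitaryTwoDesign [Finite G] (hd : 1 ≤ d) {D : Finset (UGroup d)}
    {U : G →* UGroup d} (hD : IsInducedBy D U)
    (h : tensorSqCommutant U = Submodule.span ℂ {1, swapMatrix d}) : IsUnitaryTwoDesign D := by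
  have := Fintype.ofFinite G
  have hirr := isIrreducible_of_tensorSqCommutant hd h
  refine ⟨hD.isCosetTransversal.nonempty, fun X p q => ?_⟩
  have haverage := hD.isCosetTransversal.average_eq (k := ℂ)
    (fun V => (tensorSq V * X * (tensorSq V)ᴴ) p q) fun x n hn => by
      obtain ⟨c, hc, hcn⟩ :=
        exists_coe_eq_smul_one_of_mem_repCenter hd hirr (mem_centerPreimage.1 hn)
      simp only [tensorSq_conj_apply, superoperator_mul_eq_of_coe_eq_smul_one x hc hcn]
  rw [← haarTwirl_apply, haarTwirl_eq_average h, Matrix.smul_apply, Matrix.sum_apply, haverage,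
    smul_eq_mul]

theorem IsInducedBy.isUnitaryTwoDesign_iff [Finite G] (hd : 1 ≤ d) {D : Finset (UGroup d)}
    {U : G →* UGroup d} (hD : IsInducedBy D U) :
    IsUnitaryTwoDesign D ↔ tensorSqCommutant U = Submodule.span ℂ {1, swapMatrix d} :=
  ⟨fun h => h.tensorSqCommutant_eq hD.1, hD.isUnitaryTwoDesign hd⟩

end Commutant

section SymmetricAlternating

open scoped TensorProduct

theorem trace_comm_comp_map {R M : Type*} [CommRing R] [AddCommGroup M] [Module R M]
    [Module.Free R M] [Module.Finite R M] (f g : M →ₗ[R] M) :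
    LinearMap.trace R (M ⊗[R] M) ((TensorProduct.comm R M M).toLinearMap ∘ₗ TensorProduct.map f g) =
      LinearMap.trace R M (g ∘ₗ f) := by
  let b := Free.chooseBasis R M
  rw [LinearMap.trace_eq_matrix_trace R (b.tensorProduct b), LinearMap.trace_eq_matrix_trace R b,
    LinearMap.toMatrix_comp b b b, Matrix.trace, Fintype.sum_prod_type]
  refine Finset.sum_congr rfl fun i _ => ?_
  rw [Matrix.diag_apply, Matrix.mul_apply]
  refine Finset.sum_congr rfl fun j _ => ?_
  simp [LinearMap.toMatrix_apply, Basis.tensorProduct_apply, mul_comm]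

variable {k G V : Type*} [Field k] [Group G] [AddCommGroup V] [Module k V]

theorem exists_tprod_self_eq_smul_id {ρ : Representation k G V} {g : G}
    (h : ∃ c : k, ρ g = c • LinearMap.id) : ∃ c : k, ρ.tprod ρ g = c • LinearMap.id := by
  obtain ⟨c, hc⟩ := h
  exact ⟨c * c, by rw [Representation.tprod_apply, hc, TensorProduct.map_smul_left,
    TensorProduct.map_smul_right, TensorProduct.map_id, smul_smul]⟩

/-- The eigenspace for `ε` of the swap `v ⊗ w ↦ w ⊗ v`, as a subrepresentation of `ρ ⊗ ρ`. -/
noncomputable def swapEigenspace (ρ : Representation k G V) (ε : k) :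
    Subrepresentation (ρ.tprod ρ) where
  toSubmodule := Module.End.eigenspace (TensorProduct.comm k V V).toLinearMap ε
  apply_mem_toSubmodule g v hv := by
    rw [Module.End.mem_eigenspace_iff] at hv ⊢
    rw [← map_smul, ← hv]
    exact LinearMap.congr_fun (TensorProduct.map_comp_comm_eq (ρ g) (ρ g)).symm v

theorem mem_swapEigenspace {ρ : Representation k G V} {ε : k} {v : V ⊗[k] V} :
    v ∈ (swapEigenspace ρ ε).toSubmodule ↔ TensorProduct.comm k V V v = ε • v :=
  Module.End.mem_eigenspace_iff

/-- The symmetric square of a representation. -/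
noncomputable abbrev symSub (ρ : Representation k G V) : Subrepresentation (ρ.tprod ρ) :=
  swapEigenspace ρ 1

/-- The alternating square of a representation. -/
noncomputable abbrev altSub (ρ : Representation k G V) : Subrepresentation (ρ.tprod ρ) :=
  swapEigenspace ρ (-1)

theorem isCompl_symSub_altSub [NeZero (2 : k)] (ρ : Representation k G V) :
    IsCompl (symSub ρ) (altSub ρ) := by
  rw [← isCompl_toSubmodule_iff]
  constructor
  · refine Submodule.disjoint_def.2 fun v hS hA => ?_
    rw [mem_swapEigenspace] at hS hA
    have h2 : (2 : k) • v = 0 := by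
      rw [two_smul, add_eq_zero_iff_eq_neg, ← neg_one_smul k v, ← hA, hS, one_smul]
    exact (smul_eq_zero.1 h2).resolve_left two_ne_zero
  · refine codisjoint_iff.2 (eq_top_iff.2 fun v _ => Submodule.mem_sup.2 ?_)
    have hswap := TensorProduct.comm_comm k V V v
    refine ⟨(2 : k)⁻¹ • (v + TensorProduct.comm k V V v), mem_swapEigenspace.2 ?_,
      (2 : k)⁻¹ • (v - TensorProduct.comm k V V v), mem_swapEigenspace.2 ?_, ?_⟩
    · rw [map_smul, map_add, hswap, add_comm, one_smul]
    · rw [map_smul, map_sub, hswap, neg_one_smul, ← smul_neg, neg_sub]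
    · rw [← smul_add, add_add_sub_cancel, ← two_smul k v, inv_smul_smul₀ two_ne_zero]

theorem isInternal_swapEigenspace [NeZero (2 : k)] (ρ : Representation k G V) :
    DirectSum.IsInternal fun i : Fin 2 => (swapEigenspace ρ (![1, -1] i)).toSubmodule :=
  (DirectSum.isInternal_submodule_iff_isCompl _ (i := (0 : Fin 2)) (j := 1) (by decide)
    (by ext i; fin_cases i <;> simp)).2 (isCompl_toSubmodule_iff.2 (isCompl_symSub_altSub ρ))

variable [FiniteDimensional k V]

theorem character_symSub_add_character_altSub [NeZero (2 : k)] (ρ : Representation k G V) :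
    (symSub ρ).toRepresentation.character + (altSub ρ).toRepresentation.character =
      (ρ.tprod ρ).character := by
  ext g
  exact ((LinearMap.trace_eq_sum_trace_restrict (isInternal_swapEigenspace ρ)
    fun i => (swapEigenspace ρ (![1, -1] i)).apply_mem_toSubmodule g).trans
    (Fin.sum_univ_two _)).symm

theorem character_symSub_sub_character_altSub [NeZero (2 : k)] (ρ : Representation k G V) (g : G) :
    (symSub ρ).toRepresentation.character g - (altSub ρ).toRepresentation.character g =
      ρ.character (g ^ 2) := by
  let f := (TensorProduct.comm k V V).toLinearMap ∘ₗ ρ.tprod ρ g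
  have hf : ∀ ε, ∀ v ∈ (swapEigenspace ρ ε).toSubmodule, f v = ε • ρ.tprod ρ g v := fun ε v hv =>
    mem_swapEigenspace.1 ((swapEigenspace ρ ε).apply_mem_toSubmodule g hv)
  have hmaps : ∀ ε, ∀ v ∈ (swapEigenspace ρ ε).toSubmodule,
      f v ∈ (swapEigenspace ρ ε).toSubmodule := fun ε v hv => by
    rw [hf ε v hv]
    exact Submodule.smul_mem _ _ ((swapEigenspace ρ ε).apply_mem_toSubmodule g hv)
  have htrace : ∀ ε, LinearMap.trace k _ (f.restrict (hmaps ε)) =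
      ε * (swapEigenspace ρ ε).toRepresentation.character g := fun ε => by
    have hres : f.restrict (hmaps ε) = ε • (swapEigenspace ρ ε).toRepresentation g :=
      LinearMap.ext fun v => Subtype.ext (hf ε v v.2)
    rw [hres, map_smul, smul_eq_mul]
    rfl
  calc _ = 1 * (symSub ρ).toRepresentation.character g +
        -1 * (altSub ρ).toRepresentation.character g := by ring
    _ = LinearMap.trace k _ f := by
        rw [← htrace, ← htrace, LinearMap.trace_eq_sum_trace_restrict (isInternal_swapEigenspace ρ)
          fun i => hmaps (![1, -1] i), Fin.sum_univ_two]
        rfl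
    _ = ρ.character (g ^ 2) := by
        rw [sq, character, map_mul]
        exact trace_comm_comp_map _ _

theorem two_mul_character_symSub [NeZero (2 : k)] (ρ : Representation k G V) (g : G) :
    2 * (symSub ρ).toRepresentation.character g = ρ.character g ^ 2 + ρ.character (g ^ 2) := by
  rw [← character_symSub_sub_character_altSub, sq, ← Pi.mul_apply, ← char_tensor,
    ← character_symSub_add_character_altSub, Pi.add_apply]
  ring

theorem two_mul_character_altSub [NeZero (2 : k)] (ρ : Representation k G V) (g : G) :
    2 * (altSub ρ).toRepresentation.character g = ρ.character g ^ 2 - ρ.character (g ^ 2) := by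
  rw [← character_symSub_sub_character_altSub, sq, ← Pi.mul_apply, ← char_tensor,
    ← character_symSub_add_character_altSub, Pi.add_apply]
  ring

variable [CharZero k]

theorem two_mul_finrank_symSub (ρ : Representation k G V) :
    2 * finrank k (symSub ρ).toSubmodule = finrank k V * (finrank k V + 1) := by
  have h := two_mul_character_symSub ρ 1
  rw [one_pow, char_one, char_one] at h
  rw [mul_add, mul_one, ← sq]
  exact_mod_cast h

theorem two_mul_finrank_altSub (ρ : Representation k G V) :
    2 * finrank k (altSub ρ).toSubmodule = finrank k V * (finrank k V - 1) := by
  have h := two_mul_character_altSub ρ 1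
  rw [one_pow, char_one, char_one, eq_sub_iff_add_eq] at h
  rw [Nat.mul_sub, mul_one, ← sq]
  exact Nat.eq_sub_of_add_eq (by exact_mod_cast h)

theorem finrank_symSub_ne_finrank_altSub [Nontrivial V] (ρ : Representation k G V) :
    finrank k (symSub ρ).toSubmodule ≠ finrank k (altSub ρ).toSubmodule := fun h => by
  have hS := two_mul_finrank_symSub ρ
  rw [h, two_mul_finrank_altSub, Nat.mul_right_inj finrank_pos.ne'] at hS
  omega

theorem finrank_altSub_pos (hV : 2 ≤ finrank k V) (ρ : Representation k G V) :
    0 < finrank k (altSub ρ).toSubmodule := by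
  have hpos : 0 < finrank k V * (finrank k V - 1) := Nat.mul_pos (by omega) (by omega)
  have hA := two_mul_finrank_altSub ρ
  omega

theorem finrank_altSub_le_finrank_symSub (ρ : Representation k G V) :
    finrank k (altSub ρ).toSubmodule ≤ finrank k (symSub ρ).toSubmodule := by
  have hS := two_mul_finrank_symSub ρ
  have hA := two_mul_finrank_altSub ρ
  have hle : finrank k V * (finrank k V - 1) ≤ finrank k V * (finrank k V + 1) :=
    Nat.mul_le_mul_left _ (by omega)
  omega

theorem charPairing_tprod_self_eq_two_iff [IsAlgClosed k] [Fintype G] (hV : 2 ≤ finrank k V)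
    (ρ : Representation k G V) :
    charPairing (ρ.tprod ρ).character (ρ.tprod ρ).character = 2 ↔
      IsAtom (symSub ρ) ∧ IsAtom (altSub ρ) := by
  have hA := finrank_altSub_pos hV ρ
  have : Nontrivial V := nontrivial_of_finrank_pos (R := k) (by omega)
  have : Nontrivial (altSub ρ).toSubmodule := nontrivial_of_finrank_pos (R := k) hA
  have : Nontrivial (symSub ρ).toSubmodule :=
    nontrivial_of_finrank_pos (R := k) (hA.trans_le (finrank_altSub_le_finrank_symSub ρ))
  have hne := finrank_symSub_ne_finrank_altSub ρ
  rw [isAtom_iff_isIrreducible, isAtom_iff_isIrreducible, ← character_symSub_add_character_altSub]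
  simp only [charPairing_add_left, charPairing_add_right]
  refine ⟨fun h => ?_, fun ⟨hS, hA⟩ => ?_⟩
  · have hSpos := finrank_intertwiningMap_self_pos (symSub ρ).toRepresentation
    have hApos := finrank_intertwiningMap_self_pos (altSub ρ).toRepresentation
    rw [isIrreducible_iff_charPairing, isIrreducible_iff_charPairing]
    simp only [charPairing_character] at h ⊢
    norm_cast at h ⊢
    omega
  · rw [(isIrreducible_iff_charPairing _).1 hS, (isIrreducible_iff_charPairing _).1 hA,
      charPairing_eq_zero hne, charPairing_eq_zero hne.symm]
    norm_num

theorem charPairing_tprod_self_one [IsAlgClosed k] [Fintype G] (hV : 2 < finrank k V)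
    {ρ : Representation k G V} (hS : IsAtom (symSub ρ)) (hA : IsAtom (altSub ρ)) :
    charPairing (ρ.tprod ρ).character 1 = 0 := by
  have hA1 : 1 < finrank k (altSub ρ).toSubmodule := by
    have hle : 3 * (3 - 1) ≤ finrank k V * (finrank k V - 1) := Nat.mul_le_mul hV (by omega)
    have hfinrank := two_mul_finrank_altSub ρ
    omega
  have hS1 := hA1.trans_le (finrank_altSub_le_finrank_symSub ρ)
  rw [← character_symSub_add_character_altSub, charPairing_add_left,
    charPairing_one_eq_zero ((isAtom_iff_isIrreducible _).1 hS) hS1.ne',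
    charPairing_one_eq_zero ((isAtom_iff_isIrreducible _).1 hA) hA1.ne', add_zero]

section Complex

variable {V : Type*} [AddCommGroup V] [Module ℂ V] [FiniteDimensional ℂ V]

theorem character_symSub (ρ : Representation ℂ G V) :
    (symSub ρ).toRepresentation.character = symSquare ρ.character := by
  ext g
  rw [symSquare, ← two_mul_character_symSub, mul_div_cancel_left₀ _ two_ne_zero]

theorem character_altSub (ρ : Representation ℂ G V) :
    (altSub ρ).toRepresentation.character = altSquare ρ.character := by
  ext g
  rw [altSquare, ← two_mul_character_altSub, mul_div_cancel_left₀ _ two_ne_zero]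

theorem isIrreducibleCharacter_symSquare_iff [Finite G] (ρ : Representation ℂ G V) :
    IsIrreducibleCharacter (symSquare ρ.character) ↔ IsAtom (symSub ρ) := by
  rw [← character_symSub, isIrreducibleCharacter_iff, isAtom_iff_isIrreducible]

theorem isIrreducibleCharacter_altSquare_iff [Finite G] (ρ : Representation ℂ G V) :
    IsIrreducibleCharacter (altSquare ρ.character) ↔ IsAtom (altSub ρ) := by
  rw [← character_altSub, isIrreducibleCharacter_iff, isAtom_iff_isIrreducible]

theorem exists_hasIrreducibleComponents_tprod_self_iff (hV : 2 ≤ finrank ℂ V)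
    (ρ : Representation ℂ G V) : (∃ n ≤ 2, HasIrreducibleComponents (ρ.tprod ρ) n) ↔
      IsAtom (symSub ρ) ∧ IsAtom (altSub ρ) := by
  constructor
  · rintro ⟨n, hn, h⟩
    have hc := isCompl_symSub_altSub ρ
    have hA := finrank_altSub_pos hV ρ
    have hS := hA.trans_le (finrank_altSub_le_finrank_symSub ρ)
    have hbot : ∀ σ : Subrepresentation (ρ.tprod ρ), 0 < finrank ℂ σ.toSubmodule → σ ≠ ⊥ := by
      rintro _ hσ rfl
      exact hσ.ne' (finrank_bot ℂ _)
    exact ⟨h.isAtom_of_isCompl hn hc (hbot _ hS) (hbot _ hA),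
      h.isAtom_of_isCompl hn hc.symm (hbot _ hA) (hbot _ hS)⟩
  · rintro ⟨hS, hA⟩
    refine ⟨2, le_rfl, _, isInternal_swapEigenspace ρ, fun i => ?_⟩
    fin_cases i
    · exact (isAtom_iff_isIrreducible _).1 hS
    · exact (isAtom_iff_isIrreducible _).1 hA

end Complex

end SymmetricAlternating

section GroupDesigns

variable {G : Type*} [Group G] {d : ℕ} {U : G →* UGroup d} {D : Finset (UGroup d)}

theorem charInner_rep2_eq_two_iff [Fintype G] (hd : 2 ≤ d) (U : G →* UGroup d) :
    charInner (rep2 U).character (rep2 U).character = 2 ↔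
      IsAtom (symSub (rep U)) ∧ IsAtom (altSub (rep U)) := by
  rw [charInner_rep2]
  exact charPairing_tprod_self_eq_two_iff (by rwa [finrank_fin_fun]) _

theorem IsInducedBy.isUnitaryTwoDesign_iff_charInner [Fintype G] (hd : 2 ≤ d)
    (hD : IsInducedBy D U) :
    IsUnitaryTwoDesign D ↔ charInner (rep2 U).character (rep2 U).character = 2 := by
  rw [hD.isUnitaryTwoDesign_iff (by omega), ← finrank_tensorSqCommutant_eq_two_iff hd,
    charInner_rep2_eq_finrank]
  norm_cast

theorem IsInducedBy.tfae [Fintype G] (hd : 2 ≤ d) (hD : IsInducedBy D U) : List.TFAE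
    [ IsUnitaryTwoDesign D,
      ∃ n ≤ 2, HasIrreducibleComponents (rep2 U) n,
      charInner (rep2 U).character (rep2 U).character = 2,
      IsIrreducibleCharacter (symSquare (rep U).character) ∧
        IsIrreducibleCharacter (altSquare (rep U).character) ] := by
  tfae_have 1 ↔ 3 := hD.isUnitaryTwoDesign_iff_charInner hd
  tfae_have 2 ↔ 3 := (exists_hasIrreducibleComponents_tprod_self_iff
    (by rwa [finrank_fin_fun]) (rep U)).trans (charInner_rep2_eq_two_iff hd U).symm
  tfae_have 3 ↔ 4 := by
    rw [charInner_rep2_eq_two_iff hd, isIrreducibleCharacter_symSquare_iff,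
      isIrreducibleCharacter_altSquare_iff]
  tfae_finish

theorem IsInducedBy.isIrreducible [Finite G] (hd : 1 ≤ d) (hD : IsInducedBy D U)
    (h : IsUnitaryTwoDesign D) : (rep U).IsIrreducible :=
  isIrreducible_of_tensorSqCommutant hd (h.tensorSqCommutant_eq hD.1)

theorem IsInducedBy.isAtom_symSub_and_isAtom_altSub [Finite G] (hd : 2 ≤ d)
    (hD : IsInducedBy D U) (h : IsUnitaryTwoDesign D) :
    IsAtom (symSub (rep U)) ∧ IsAtom (altSub (rep U)) := by
  have := Fintype.ofFinite G
  exact (charInner_rep2_eq_two_iff hd U).1 ((hD.isUnitaryTwoDesign_iff_charInner hd).1 h)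

theorem exists_rep_eq_smul_id (hd : 1 ≤ d) (hU : (rep U).IsIrreducible) {n : G}
    (hn : n ∈ centerPreimage U) : ∃ c : ℂ, rep U n = c • LinearMap.id := by
  obtain ⟨c, -, hc⟩ := exists_coe_eq_smul_one_of_mem_repCenter hd hU (mem_centerPreimage.1 hn)
  refine ⟨c, ?_⟩
  change Matrix.toLin' (U n).1 = _
  rw [hc, map_smul, Matrix.toLin'_one]

theorem IsInducedBy.dvd_card [Finite G] (hd : 2 ≤ d) (hD : IsInducedBy D U)
    (h : IsUnitaryTwoDesign D) :
    d ∣ D.card ∧ d * (d + 1) / 2 ∣ D.card ∧ d * (d - 1) / 2 ∣ D.card := by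
  have hU := hD.isIrreducible (by omega) h
  obtain ⟨hS, hA⟩ := hD.isAtom_symSub_and_isAtom_altSub hd h
  have hscalar : ∀ n ∈ centerPreimage U, ∃ c : ℂ, rep U n = c • LinearMap.id :=
    fun n hn => exists_rep_eq_smul_id (by omega) hU hn
  have hscalar_tprod := fun n hn => exists_tprod_self_eq_smul_id (hscalar n hn)
  have hSdim := two_mul_finrank_symSub (rep U)
  have hAdim := two_mul_finrank_altSub (rep U)
  rw [finrank_fin_fun] at hSdim hAdim
  rw [hD.isCosetTransversal.card_eq_index, ← hSdim, ← hAdim, Nat.mul_div_cancel_left _ two_pos,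
    Nat.mul_div_cancel_left _ two_pos]
  exact ⟨by simpa using finrank_dvd_index hU hscalar,
    finrank_dvd_index_of_isAtom hS hscalar_tprod, finrank_dvd_index_of_isAtom hA hscalar_tprod⟩

theorem framePotential_matrixGroup_le_of_range_subset {H : Type*} [Group H] [Finite G] [Finite H]
    {V : H →* UGroup d} (h : Set.range U ⊆ Set.range V) :
    framePotential (matrixGroup V) ≤ framePotential (matrixGroup U) :=
  have hU := isCosetTransversal_matrixGroup U
  framePotential_matrixGroup_le V hU.nonempty fun x hx => h (hU.mem_range x hx)

theorem IsInducedBy.framePotential_eq_matrixGroup [Finite G] (hd : 1 ≤ d) (hD : IsInducedBy D U)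
    (hU : (rep U).IsIrreducible) : framePotential D = framePotential (matrixGroup U) := by
  have := Fintype.ofFinite G
  exact Complex.ofReal_injective <| by
    rw [framePotential_eq_trace, framePotential_eq_trace, hD.twirlMatrix_eq hd hU,
      twirlMatrix_matrixGroup]

theorem IsInducedBy.framePotential_le_of_range_subset {H : Type*} [Group H] [Finite H]
    (hd : 1 ≤ d) (hD : IsInducedBy D U) {V : H →* UGroup d} (hUV : Set.range U ⊆ Set.range V)
    (hV : (rep V).IsIrreducible) {E : Finset (UGroup d)} (hE : IsInducedBy E V) :
    framePotential E ≤ framePotential D := by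
  rw [hE.framePotential_eq_matrixGroup hd hV]
  exact framePotential_matrixGroup_le V hD.isCosetTransversal.nonempty fun x hx => hUV (hD.1 x hx)

theorem charPairing_rep2_one [Fintype G] (hreal : ∀ g, ((rep U).character g).im = 0) :
    charPairing (rep2 U).character 1 = charPairing (rep U).character (rep U).character := by
  refine congrArg _ (Finset.sum_congr rfl fun g _ => ?_)
  rw [character_rep_inv, Complex.conj_eq_iff_im.2 (hreal g), character_rep2, Pi.one_apply, mul_one,
    sq]

theorem IsInducedBy.not_isUnitaryTwoDesign_of_real [Finite G] (hd : 2 < d) (hD : IsInducedBy D U)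
    (hreal : ∀ g, ((rep U).character g).im = 0) : ¬ IsUnitaryTwoDesign D := by
  intro h
  have := Fintype.ofFinite G
  obtain ⟨hS, hA⟩ := hD.isAtom_symSub_and_isAtom_altSub hd.le h
  have hone := (isIrreducible_iff_charPairing _).1 (hD.isIrreducible (by omega) h)
  have hzero := charPairing_tprod_self_one (by rwa [finrank_fin_fun]) hS hA
  exact zero_ne_one (hzero.symm.trans ((charPairing_rep2_one hreal).trans hone))

theorem im_character_rep_eq_zero (h : ∀ g i j, ((U g : Matrix (Fin d) (Fin d) ℂ) i j).im = 0)
    (g : G) : ((rep U).character g).im = 0 := by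
  rw [character_rep, Matrix.trace, Complex.im_sum]
  exact Finset.sum_eq_zero fun i _ => h g i i

end GroupDesigns

end GroupDesign

theorem theorem3 {G : Type*} [Group G] [Fintype G] {d : ℕ} (hd : 1 ≤ d)
    (U : G →* GroupDesign.UGroup d) (D : Finset (GroupDesign.UGroup d))
    (hD : GroupDesign.IsInducedBy D U) :
    -- equivalence of 1., 2., 3., 4.
    (2 ≤ d → List.TFAE
      [ GroupDesign.IsUnitaryTwoDesign D,
        ∃ n ≤ 2, GroupDesign.HasIrreducibleComponents (GroupDesign.rep2 U) n,
        GroupDesign.charInner (GroupDesign.rep2 U).character (GroupDesign.rep2 U).character = 2,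
        GroupDesign.IsIrreducibleCharacter
            (GroupDesign.symSquare (GroupDesign.rep U).character) ∧
          GroupDesign.IsIrreducibleCharacter
            (GroupDesign.altSquare (GroupDesign.rep U).character) ]) ∧
    -- 5. divisibility of the cardinality of a 2-design
    (2 ≤ d → GroupDesign.IsUnitaryTwoDesign D →
      d ∣ D.card ∧ d * (d + 1) / 2 ∣ D.card ∧ d * (d - 1) / 2 ∣ D.card) ∧
    -- 6. supergroups have frame potential at most that of their subgroups
    (∀ (H : Type*) [Group H] [Finite H] (V : H →* GroupDesign.UGroup d),
      Set.range U ⊆ Set.range V →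
        GroupDesign.framePotential (GroupDesign.matrixGroup V) ≤
          GroupDesign.framePotential (GroupDesign.matrixGroup U) ∧
        ((GroupDesign.rep V).IsIrreducible →
          ∀ E : Finset (GroupDesign.UGroup d), GroupDesign.IsInducedBy E V →
            GroupDesign.framePotential E ≤ GroupDesign.framePotential D)) ∧
    -- 7. the frame potential of a matrix group is an integer
    ((∃ m : ℤ, GroupDesign.framePotential (GroupDesign.matrixGroup U) = m) ∧
      ((GroupDesign.rep U).IsIrreducible → ∃ m : ℤ, GroupDesign.framePotential D = m)) ∧
    -- 8. irreducibility is necessary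
    (GroupDesign.IsUnitaryTwoDesign D → (GroupDesign.rep U).IsIrreducible) ∧
    -- 9. no real representation in dimension greater than 2
    (2 < d →
      ((∀ g i j, ((U g : Matrix (Fin d) (Fin d) ℂ) i j).im = 0) ∨
        (∀ g, ((GroupDesign.rep U).character g).im = 0)) →
      ¬ GroupDesign.IsUnitaryTwoDesign D) := by
  refine ⟨fun hd2 => hD.tfae hd2, fun hd2 h => hD.dvd_card hd2 h, fun H _ _ V hUV =>
      ⟨GroupDesign.framePotential_matrixGroup_le_of_range_subset hUV, fun hV E hE =>
        hD.framePotential_le_of_range_subset hd hUV hV hE⟩,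
    ⟨GroupDesign.exists_framePotential_eq_intCast (GroupDesign.twirlMatrix_matrixGroup U), fun hU =>
      GroupDesign.exists_framePotential_eq_intCast (hD.twirlMatrix_eq hd hU)⟩,
    hD.isIrreducible hd, fun hd2 hreal => ?_⟩
  exact hD.not_isUnitaryTwoDesign_of_real hd2
    (hreal.elim GroupDesign.im_character_rep_eq_zero id)
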